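/- Let $(S,d)$ be a complete separable metric space and let $\mathcal{P}(S)$ be the set of Borel probability measures on $S$, endowed with the topology of weak convergence. Let $(\Omega,\mathcal{F},P)$ be a complete nonatomic probability space (nonatomic: every $A\in\mathcal{F}$ with $P(A)>0$ contains some $B\in\mathcal{F}$ with $0<P(B)<P(A)$), and let $L^0(\Omega,S)$ be the space of $S$-valued random variables on $\Omega$, modulo almost sure equality, endowed with the topology of convergence in probability, i.e. with the metric $$\rho(X,Y)=\inf\{\varepsilon>0 : P\{\omega : d(X(\omega),Y(\omega))\ge\varepsilon\}\le\varepsilon\}.$$ For $X\in L^0(\Omega,S)$ let $law(X)\in\mathcal{P}(S)$ be its distribution, $law(X)(A)=P(X^{-1}(A))$. Let $n\ge 0$ be an integer, let $\alpha:[0,1]^n\to\mathcal{P}(S)$ be continuous, and let $X:\partial[0,1]^n\to L^0(\Omega,S)$ be a continuous function on the boundary of the cube (the set of points with some coordinate equal to $0$ or $1$, which is empty for $n=0$) such that $law(X(t))=\alpha(t)$ for all $t\in\partial[0,1]^n$. Then there is a continuous function $\hat\alpha:[0,1]^n\to L^0(\Omega,S)$ such that $\hat\alpha(t)=X(t)$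 for all $t\in\partial[0,1]^n$ and $law(\hat\alpha(t))=\alpha(t)$ for all $t\in[0,1]^n$. -/

import Mathlib

open MeasureTheory Filter Topology

/-- A measure without atoms in the measure-theoretic sense: every measurable set of positive
measure has a measurable subset of strictly smaller positive measure. (Vanishing on singletons is
a different, weaker notion.) -/
def Nonatomic {Ω : Type*} [MeasurableSpace Ω] (P : Measure Ω) : Prop :=
  ∀ A : Set Ω, MeasurableSet A → 0 < P A →
    ∃ B : Set Ω, MeasurableSet B ∧ B ⊆ A ∧ 0 < P B ∧ P B < P A

namespace L0

variable {Ω : Type*} [MeasurableSpace Ω] {P : Measure Ω} {S : Type*} [MetricSpace S]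

/-- The positive reals `ε` with `P (d(X, Y) ≥ ε) ≤ ε`. -/
def rhoSet (X Y : Ω →ₘ[P] S) : Set ℝ :=
  {ε : ℝ | 0 < ε ∧ P.real {ω | ε ≤ dist (X ω) (Y ω)} ≤ ε}

/-- The Ky Fan distance `ρ(X, Y) = inf {ε > 0 : P (d(X, Y) ≥ ε) ≤ ε}`. -/
noncomputable def rho (X Y : Ω →ₘ[P] S) : ℝ := sInf (rhoSet X Y)

theorem rhoSet_bddBelow (X Y : Ω →ₘ[P] S) : BddBelow (rhoSet X Y) :=
  ⟨0, fun _ h => h.1.le⟩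

theorem rho_le {X Y : Ω →ₘ[P] S} {ε : ℝ} (h : ε ∈ rhoSet X Y) : rho X Y ≤ ε :=
  csInf_le (rhoSet_bddBelow X Y) h

theorem rho_nonneg (X Y : Ω →ₘ[P] S) : 0 ≤ rho X Y :=
  Real.sInf_nonneg fun _ h => h.1.le

theorem rho_comm (X Y : Ω →ₘ[P] S) : rho X Y = rho Y X := by
  simp only [rho, rhoSet, dist_comm]

theorem rho_self (X : Ω →ₘ[P] S) : rho X X = 0 := by
  refine le_antisymm (le_of_forall_pos_le_add fun ε hε => ?_) (rho_nonneg X X)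
  rw [zero_add]
  refine rho_le ⟨hε, ?_⟩
  simp [not_le.2 hε, hε.le]

variable [IsProbabilityMeasure P]

theorem one_mem_rhoSet (X Y : Ω →ₘ[P] S) : (1 : ℝ) ∈ rhoSet X Y :=
  ⟨one_pos, measureReal_le_one⟩

theorem exists_mem_rhoSet_lt {X Y : Ω →ₘ[P] S} {ε : ℝ} (h : rho X Y < ε) :
    ∃ δ ∈ rhoSet X Y, δ < ε :=
  exists_lt_of_csInf_lt ⟨1, one_mem_rhoSet X Y⟩ h

theorem rho_triangle (X Y Z : Ω →ₘ[P] S) : rho X Z ≤ rho X Y + rho Y Z := by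
  refine le_of_forall_pos_le_add fun ε hε => ?_
  obtain ⟨a, ha, ha'⟩ := exists_mem_rhoSet_lt (show rho X Y < rho X Y + ε / 2 by linarith)
  obtain ⟨b, hb, hb'⟩ := exists_mem_rhoSet_lt (show rho Y Z < rho Y Z + ε / 2 by linarith)
  have hab : a + b ∈ rhoSet X Z := by
    refine ⟨add_pos ha.1 hb.1, ?_⟩
    have hsub : {ω | a + b ≤ dist (X ω) (Z ω)} ⊆
        {ω | a ≤ dist (X ω) (Y ω)} ∪ {ω | b ≤ dist (Y ω) (Z ω)} := by
      intro ω hω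
      by_contra hc
      simp only [Set.mem_union, Set.mem_ofPred_eq, not_or, not_le] at hc hω
      have := dist_triangle (X ω) (Y ω) (Z ω)
      linarith [hc.1, hc.2]
    calc _ ≤ _ := measureReal_mono hsub
      _ ≤ _ := measureReal_union_le _ _
      _ ≤ a + b := add_le_add ha.2 hb.2
  linarith [rho_le hab]

theorem measureReal_le_of_rho_lt {X Y : Ω →ₘ[P] S} {ε : ℝ} (h : rho X Y < ε) :
    P.real {ω | ε ≤ dist (X ω) (Y ω)} ≤ ε := by
  obtain ⟨δ, hδ, hlt⟩ := exists_mem_rhoSet_lt h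
  calc _ ≤ P.real {ω | δ ≤ dist (X ω) (Y ω)} :=
        measureReal_mono fun ω (hω : ε ≤ _) => hlt.le.trans hω
    _ ≤ δ := hδ.2
    _ ≤ ε := hlt.le

theorem eq_of_rho_eq_zero {X Y : Ω →ₘ[P] S} (h : rho X Y = 0) : X = Y := by
  have key : ∀ ε : ℝ, 0 < ε → P {ω | ε ≤ dist (X ω) (Y ω)} = 0 := by
    intro ε hε
    rw [← measureReal_eq_zero_iff]
    refine le_antisymm (le_of_forall_pos_le_add fun δ hδ => ?_) measureReal_nonneg
    rw [zero_add]
    have hm : 0 < min ε δ := lt_min hε hδ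
    calc _ ≤ P.real {ω | min ε δ ≤ dist (X ω) (Y ω)} :=
          measureReal_mono fun ω (hω : ε ≤ _) => (min_le_left ε δ).trans hω
      _ ≤ min ε δ := measureReal_le_of_rho_lt (h ▸ hm)
      _ ≤ δ := min_le_right _ _
  refine AEEqFun.ext ?_
  have hall : ∀ᵐ ω ∂P, ∀ n : ℕ, dist (X ω) (Y ω) < 1 / ((n : ℝ) + 1) := by
    refine ae_all_iff.2 fun n => ?_
    have := key (1 / ((n : ℝ) + 1)) Nat.one_div_pos_of_nat
    simpa [ae_iff] using this
  filter_upwards [hall] with ω hω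
  by_contra hne
  obtain ⟨n, hn⟩ := exists_nat_one_div_lt (dist_pos.2 hne)
  exact absurd (hω n) (not_lt.2 hn.le)

/-- `L⁰(Ω, S)`, the space of (a.s. classes of) `S`-valued random variables, with the metric `ρ`,
that is, with the topology of convergence in probability. -/
noncomputable instance instMetricSpace : MetricSpace (Ω →ₘ[P] S) where
  dist := rho
  dist_self := rho_self
  dist_comm := rho_comm
  dist_triangle := rho_triangle
  eq_of_dist_eq_zero := eq_of_rho_eq_zero

/-- Convergence for the topology of `L⁰(Ω, S)` is convergence in probability. -/
theorem tendsto_iff_tendstoInMeasure {ι : Type*} {l : Filter ι} {X : ι → (Ω →ₘ[P] S)}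
    {Y : Ω →ₘ[P] S} :
    Tendsto X l (𝓝 Y) ↔ TendstoInMeasure P (fun i => (X i : Ω → S)) l Y := by
  rw [tendstoInMeasure_iff_measureReal_dist, Metric.tendsto_nhds]
  constructor
  · intro h ε hε
    rw [Metric.tendsto_nhds]
    intro δ hδ
    have hm : 0 < min ε (δ / 2) := lt_min hε (half_pos hδ)
    filter_upwards [h _ hm] with i hi
    rw [Real.dist_eq, sub_zero, abs_of_nonneg measureReal_nonneg]
    calc _ ≤ P.real {ω | min ε (δ / 2) ≤ dist (X i ω) (Y ω)} :=
          measureReal_mono fun ω (hω : ε ≤ _) => (min_le_left _ _).trans hω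
      _ ≤ min ε (δ / 2) := measureReal_le_of_rho_lt hi
      _ ≤ δ / 2 := min_le_right _ _
      _ < δ := half_lt_self hδ
  · intro h ε hε
    filter_upwards [(h (ε / 2) (half_pos hε)).eventually_lt_const (half_pos hε)] with i hi
    exact lt_of_le_of_lt (rho_le ⟨half_pos hε, hi.le⟩) (half_lt_self hε)

/-- The law (distribution) of a random variable: `law X A = P (X ∈ A)`. -/
noncomputable def law [MeasurableSpace S] [BorelSpace S] (X : Ω →ₘ[P] S) :
    ProbabilityMeasure S :=
  ⟨P.map X, Measure.isProbabilityMeasure_map X.aestronglyMeasurable.aemeasurable⟩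

end L0

open scoped BoundedContinuousFunction

/-! A Skorokhod representation turns a weakly continuous family of measures into random variables
that are continuous in probability. The difficulty is to make them tend to `X` at the boundary. Off
the boundary, take a Whitney partition of unity `φ j`, with bounded multiplicity and supports small
where the depth is small. Let `D j` be a discretisation of `X` at a boundary point nearest to some
point of the support of `φ j`. Nonatomicity provides a random variable `U` without atoms
(`Nonatomic.exists_diffuse`), which chooses among the `D j`: at `t` the index is the `j` for which
`U` lies between the `j`-th and the next partial sum of the `φ j t`. The variable `U` need not be
independent of the `D j`, but at most `N` of them are active at `t`, so a union bound shows that the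
chosen label is close to `X b` in probability when `t` is close to `b`.

The law must then be corrected by a small displacement. The pairs `l = (j, i)` of index and label
cut `Ω` into slots whose masses depend continuously on `t`. By `exists_continuous_splitting`, `α t`
is a sum of measures `M t l` with these masses, weakly continuous in `t` and, near the boundary,
mostly carried near `x i`. This is a continuous selection of couplings: the admissible densities
form a convex set, and a finite family satisfying strict inequalities serves for all nearby
parameters. Such families with small loss come from `hasStrictSubcoupling_of_close`, and
`exists_modulus` chooses the permitted loss `δ t`, which tends to zero at the boundary.

Finally, `exists_continuous_of_slot_measures` realises `M t l` on its slot: the distribution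
function of `U` on the slot makes `U` uniform on an interval, and `PartitionSeq.repr`, which is
jointly continuous in measure and point off a null set, is applied to the result. Markov's
inequality turns the small loss into closeness to the label, hence to `X b`. -/

/-- Monotone convergence for series of nonnegative bounded continuous functions. -/
theorem hasSum_integral_of_hasSum {S L : Type*} [TopologicalSpace S] [MeasurableSpace S]
    [OpensMeasurableSpace S] [Countable L] {M : Measure S} [IsFiniteMeasure M] {g : L → S →ᵇ ℝ}
    {G : S →ᵇ ℝ} (h0 : ∀ l y, 0 ≤ g l y) (h : ∀ y, HasSum (fun l => g l y) (G y)) :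
    HasSum (fun l => ∫ y, g l y ∂M) (∫ y, G y ∂M) := by
  have hG0 : ∀ y, 0 ≤ G y := fun y => (h y).nonneg fun l => h0 l y
  have h1 : ∀ y, ∑' l, ENNReal.ofReal (g l y) = ENNReal.ofReal (G y) := fun y => by
    rw [← ENNReal.ofReal_tsum_of_nonneg (fun l => h0 l y) (h y).summable, (h y).tsum_eq]
  have h2 : ∀ f : S →ᵇ ℝ, (∀ y, 0 ≤ f y) →
      ENNReal.ofReal (∫ y, f y ∂M) = ∫⁻ y, ENNReal.ofReal (f y) ∂M := fun f hf =>
    ofReal_integral_eq_lintegral_ofReal (f.integrable M) (ae_of_all _ hf)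
  have h3 : ∑' l, ENNReal.ofReal (∫ y, g l y ∂M) = ENNReal.ofReal (∫ y, G y ∂M) := by
    rw [h2 G hG0, tsum_congr fun l => h2 (g l) (h0 l),
      ← lintegral_tsum fun l => (g l).continuous.measurable.ennreal_ofReal.aemeasurable]
    simp_rw [h1]
  have hg : ∀ l, 0 ≤ ∫ y, g l y ∂M := fun l => integral_nonneg (h0 l)
  have h4 := ENNReal.hasSum_toReal (h3 ▸ ENNReal.ofReal_ne_top)
  simp only [ENNReal.toReal_ofReal (hg _)] at h4
  rwa [← ENNReal.toReal_ofReal (integral_nonneg hG0 : 0 ≤ ∫ y, G y ∂M), ← h3,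
    ENNReal.tsum_toReal_eq (fun l => ENNReal.ofReal_ne_top),
    tsum_congr fun l => ENNReal.toReal_ofReal (hg l)]

/-! ### Continuous partitions of unity of small mesh -/

section UnitPartition

variable {S : Type*} [MetricSpace S]

/-- The tent function that is `1` on the ball of radius `ε / 2` and `0` off the ball of
radius `ε`. -/
noncomputable def tent (z : S) (ε : ℝ) : S →ᵇ ℝ :=
  BoundedContinuousFunction.ofNormedAddCommGroup
    (fun y => max 0 (min 1 (2 - 2 * dist y z / ε))) (by fun_prop) 1 (fun y => by
      rw [Real.norm_eq_abs, abs_of_nonneg (le_max_left _ _)]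
      exact max_le zero_le_one (min_le_left _ _))

theorem tent_apply (z : S) (ε : ℝ) (y : S) :
    tent z ε y = max 0 (min 1 (2 - 2 * dist y z / ε)) := rfl

theorem tent_nonneg (z : S) (ε : ℝ) (y : S) : 0 ≤ tent z ε y := le_max_left _ _

theorem tent_le_one (z : S) (ε : ℝ) (y : S) : tent z ε y ≤ 1 :=
  max_le zero_le_one (min_le_left _ _)

theorem tent_eq_one {z : S} {ε : ℝ} (hε : 0 < ε) {y : S} (h : dist y z ≤ ε / 2) :
    tent z ε y = 1 := by
  have : 2 * dist y z / ε ≤ 1 := by rw [div_le_one hε]; linarith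
  rw [tent_apply, min_eq_left (by linarith), max_eq_right zero_le_one]

theorem dist_lt_of_tent_ne_zero {z : S} {ε : ℝ} (hε : 0 < ε) {y : S} (h : tent z ε y ≠ 0) :
    dist y z < ε := by
  by_contra hc
  have : 2 ≤ 2 * dist y z / ε := by rw [le_div_iff₀ hε]; linarith
  exact h (by rw [tent_apply, max_eq_left ((min_le_right _ _).trans (by linarith))])

/-- A metric space with a dense sequence has countable continuous partitions of unity of
arbitrarily small mesh. -/
theorem exists_unit_partition {x : ℕ → S} (hx : DenseRange x) {ε : ℝ} (hε : 0 < ε) :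
    ∃ f : ℕ → S →ᵇ ℝ, (∀ i y, 0 ≤ f i y) ∧ (∀ y, HasSum (fun i => f i y) 1) ∧
      ∀ i y, f i y ≠ 0 → dist y (x i) < ε := by
  -- `T m` is what the first `m` tents leave of `1`. Cutting off the next tent from it makes the
  -- partial sums telescope to `1 - T m`, and density makes `T m y` vanish for large `m`.
  set T : ℕ → S →ᵇ ℝ := fun m => ∏ i ∈ Finset.range m, (1 - tent (x i) ε) with hT
  have hTapp : ∀ m y, T m y = ∏ i ∈ Finset.range m, (1 - tent (x i) ε y) := by
    intro m y
    induction m with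
    | zero => simp [hT]
    | succ m ih =>
      rw [Finset.prod_range_succ, ← ih]
      simp [hT, Finset.prod_range_succ]
  have hT0 : ∀ m y, 0 ≤ T m y := fun m y => by
    rw [hTapp]
    exact Finset.prod_nonneg fun i _ => by linarith [tent_le_one (x i) ε y]
  refine ⟨fun i => T i * tent (x i) ε, fun i y => ?_, fun y => ?_, fun i y h => ?_⟩
  · exact mul_nonneg (hT0 i y) (tent_nonneg _ _ _)
  · change HasSum (fun i => (T i * tent (x i) ε) y) 1
    have hsum : ∀ m, ∑ i ∈ Finset.range m, (T i * tent (x i) ε) y = 1 - T m y := by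
      intro m
      induction m with
      | zero => simp [hTapp]
      | succ m ih =>
        rw [Finset.sum_range_succ, ih, hTapp (m + 1), Finset.prod_range_succ, ← hTapp]
        simp only [BoundedContinuousFunction.coe_mul, Pi.mul_apply]
        ring
    rw [hasSum_iff_tendsto_nat_of_nonneg
      (fun i => show 0 ≤ (T i * tent (x i) ε) y from mul_nonneg (hT0 i y) (tent_nonneg _ _ _))]
    obtain ⟨i, hi⟩ := hx.exists_dist_lt y (half_pos hε)
    refine tendsto_const_nhds.congr' ?_
    filter_upwards [eventually_gt_atTop i] with m hm
    rw [hsum, hTapp, Finset.prod_eq_zero (Finset.mem_range.2 hm), sub_zero]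
    rw [tent_eq_one hε hi.le, sub_self]
  · exact dist_lt_of_tent_ne_zero hε (right_ne_zero_of_mul h)

/-- A sequence of countable continuous partitions of unity, the `k`-th of which has mesh
`2⁻ᵏ`. -/
structure PartitionSeq (x : ℕ → S) where
  f : ℕ → ℕ → S →ᵇ ℝ
  nonneg : ∀ k i y, 0 ≤ f k i y
  hasSum : ∀ k y, HasSum (fun i => f k i y) 1
  dist_lt : ∀ k i y, f k i y ≠ 0 → dist y (x i) < (1 / 2) ^ k

theorem nonempty_partitionSeq {x : ℕ → S} (hx : DenseRange x) : Nonempty (PartitionSeq x) := by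
  choose f h1 h2 h3 using fun k : ℕ =>
    exists_unit_partition hx (show (0 : ℝ) < (1 / 2) ^ k by positivity)
  exact ⟨⟨f, h1, h2, h3⟩⟩

end UnitPartition

/-! ### Skorokhod representation by nested intervals -/

namespace PartitionSeq

variable {S : Type*} [MetricSpace S] {x : ℕ → S} (F : PartitionSeq x)

/-- The products of functions of the first partitions of unity. The most recent index is the
head of the list. -/
noncomputable def weight : List ℕ → S →ᵇ ℝ
  | [] => 1
  | i :: s => weight s * F.f s.length i

theorem weight_cons (i : ℕ) (s : List ℕ) (y : S) :
    F.weight (i :: s) y = F.weight s y * F.f s.length i y := rfl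

theorem weight_nonneg (s : List ℕ) (y : S) : 0 ≤ F.weight s y := by
  induction s with
  | nil => exact zero_le_one
  | cons i s ih => exact mul_nonneg ih (F.nonneg _ _ _)

theorem hasSum_weight (s : List ℕ) (y : S) :
    HasSum (fun i => F.weight (i :: s) y) (F.weight s y) := by
  simpa only [weight_cons, mul_one] using (F.hasSum s.length y).mul_left (F.weight s y)

variable [MeasurableSpace S]

/-- The length of a cell. -/
noncomputable def mass (M : Measure S) (s : List ℕ) : ℝ := ∫ y, F.weight s y ∂M

/-- The left end of a cell. -/
noncomputable def left (M : Measure S) : List ℕ → ℝ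
  | [] => 0
  | i :: s => left M s + ∑ j ∈ Finset.range i, F.mass M (j :: s)

/-- The cells of each level partition `[0, M S)`; those of the next level refine them. -/
noncomputable def cell (M : Measure S) (s : List ℕ) : Set ℝ :=
  Set.Ico (F.left M s) (F.left M s + F.mass M s)

theorem mass_nonneg (M : Measure S) (s : List ℕ) : 0 ≤ F.mass M s :=
  integral_nonneg fun y => F.weight_nonneg s y

theorem left_succ (M : Measure S) (i : ℕ) (s : List ℕ) :
    F.left M ((i + 1) :: s) = F.left M (i :: s) + F.mass M (i :: s) := by
  simp only [left, Finset.sum_range_succ]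
  ring

theorem left_mono (M : Measure S) (s : List ℕ) : Monotone fun i => F.left M (i :: s) :=
  monotone_nat_of_le_succ fun i => by
    rw [left_succ]
    linarith [F.mass_nonneg M (i :: s)]

theorem cell_cons (M : Measure S) (i : ℕ) (s : List ℕ) :
    F.cell M (i :: s) = Set.Ico (F.left M (i :: s)) (F.left M ((i + 1) :: s)) := by
  rw [cell, left_succ]

theorem eq_of_mem_cell {M : Measure S} {u : ℝ} {i j : ℕ} {s : List ℕ}
    (hi : u ∈ F.cell M (i :: s)) (hj : u ∈ F.cell M (j :: s)) : i = j := by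
  rw [cell_cons] at hi hj
  by_contra hne
  rcases lt_or_gt_of_ne hne with h | h
  · exact absurd (hi.2.trans_le ((F.left_mono M s h).trans hj.1)) (lt_irrefl _)
  · exact absurd (hj.2.trans_le ((F.left_mono M s h).trans hi.1)) (lt_irrefl _)

open Classical in
/-- The index of the subcell of the cell `s` that contains `u`. -/
noncomputable def step (M : Measure S) (u : ℝ) (s : List ℕ) : ℕ :=
  if h : ∃ i, u ∈ F.cell M (i :: s) then Nat.find h else 0

/-- The indices of the cells that contain `u`. -/
noncomputable def path (M : Measure S) (u : ℝ) : ℕ → List ℕ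
  | 0 => []
  | k + 1 => F.step M u (path M u k) :: path M u k

theorem length_path (M : Measure S) (u : ℝ) (k : ℕ) : (F.path M u k).length = k := by
  induction k with
  | zero => rfl
  | succ k ih => simp [path, ih]

theorem step_eq {M : Measure S} {u : ℝ} {i : ℕ} {s : List ℕ} (h : u ∈ F.cell M (i :: s)) :
    F.step M u s = i := by
  classical
  have h' : ∃ i, u ∈ F.cell M (i :: s) := ⟨i, h⟩
  rw [step, dif_pos h']
  exact F.eq_of_mem_cell (Nat.find_spec h') h

/-- Measurability of `path` rests on this description. The second alternative is the default value
of `step` outside all subcells. -/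
theorem step_eq_iff {M : Measure S} {u : ℝ} {i : ℕ} {s : List ℕ} :
    F.step M u s = i ↔ u ∈ F.cell M (i :: s) ∨ i = 0 ∧ ∀ j, u ∉ F.cell M (j :: s) := by
  classical
  by_cases h : ∃ j, u ∈ F.cell M (j :: s)
  · obtain ⟨j, hj⟩ := h
    rw [F.step_eq hj]
    refine ⟨fun e => Or.inl (e ▸ hj), ?_⟩
    rintro (h | h)
    · exact F.eq_of_mem_cell hj h
    · exact absurd hj (h.2 j)
  · have h2 := not_exists.1 h
    simp [step, h2, eq_comm]

theorem measurableSet_path (M : Measure S) (k : ℕ) (s : List ℕ) :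
    MeasurableSet {u | F.path M u k = s} := by
  induction k generalizing s with
  | zero => simp only [path]; exact MeasurableSet.const _
  | succ k ih =>
    cases s with
    | nil => simp [path]
    | cons i s =>
      have : {u | F.path M u (k + 1) = i :: s} = {u | F.path M u k = s} ∩
          (F.cell M (i :: s) ∪ ({u | i = 0} ∩ ⋂ j, (F.cell M (j :: s))ᶜ)) := by
        ext u
        simp only [path, List.cons.injEq, Set.mem_ofPred_eq, Set.mem_inter_iff, Set.mem_union,
          Set.mem_iInter, Set.mem_compl_iff]
        constructor
        · rintro ⟨h1, rfl⟩
          exact ⟨rfl, F.step_eq_iff.1 h1⟩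
        · rintro ⟨rfl, h⟩
          exact ⟨F.step_eq_iff.2 h, rfl⟩
      rw [this]
      exact (ih s).inter (measurableSet_Ico.union ((MeasurableSet.const _).inter
        (MeasurableSet.iInter fun j => measurableSet_Ico.compl)))

/-- The centre of the `k`-th cell that contains `u`. -/
noncomputable def point (M : Measure S) (u : ℝ) (k : ℕ) : S := x (F.step M u (F.path M u k))

theorem point_eq_headI (M : Measure S) (u : ℝ) (k : ℕ) :
    F.point M u k = x (F.path M u (k + 1)).headI := rfl

theorem measurable_point (M : Measure S) (k : ℕ) : Measurable fun u => F.point M u k := by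
  let : MeasurableSpace (List ℕ) := ⊤
  have h : Measurable fun u => F.path M u (k + 1) :=
    measurable_to_countable' fun s => F.measurableSet_path M (k + 1) s
  exact (measurable_from_top (f := fun s : List ℕ => x s.headI)).comp h

theorem dist_point_lt_of_weight_ne_zero {M : Measure S} {u : ℝ} {m : ℕ} {y : S}
    (h : F.weight (F.path M u m) y ≠ 0) {k : ℕ} (hk : k < m) :
    dist y (F.point M u k) < (1 / 2) ^ k := by
  induction m with
  | zero => omega
  | succ m ih =>
    rw [path, weight_cons, length_path] at h
    rcases Nat.lt_succ_iff_lt_or_eq.1 hk with h' | rfl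
    · exact ih (left_ne_zero_of_mul h) h'
    · exact F.dist_lt _ _ _ (right_ne_zero_of_mul h)

open Classical in
/-- The representation of the measure `M` by a function on `[0, M S)`. -/
noncomputable def repr (M : Measure S) (u : ℝ) : S :=
  haveI : Nonempty S := ⟨x 0⟩
  if u ∈ Set.Ico 0 (M.real Set.univ) then limUnder atTop (F.point M u) else x 0

theorem cell_nil (M : Measure S) : F.cell M [] = Set.Ico 0 (M.real Set.univ) := by
  simp [cell, left, mass, weight]

variable [BorelSpace S] {M : Measure S} [IsFiniteMeasure M]

theorem integrable_weight (s : List ℕ) : Integrable (F.weight s) M :=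
  (F.weight s).integrable M

theorem hasSum_mass (s : List ℕ) : HasSum (fun i => F.mass M (i :: s)) (F.mass M s) :=
  hasSum_integral_of_hasSum (fun _ => F.weight_nonneg _) (F.hasSum_weight s)

theorem left_cons_le (i : ℕ) (s : List ℕ) : F.left M (i :: s) ≤ F.left M s + F.mass M s := by
  simp only [left]
  gcongr
  exact sum_le_hasSum _ (fun j _ => F.mass_nonneg M _) (F.hasSum_mass s)

theorem cell_cons_subset (i : ℕ) (s : List ℕ) : F.cell M (i :: s) ⊆ F.cell M s := by
  rw [cell_cons]
  refine Set.Ico_subset_Ico ?_ (F.left_cons_le _ s)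
  simpa [left] using F.left_mono M s (Nat.zero_le i)

theorem cell_subset_cell_nil (s : List ℕ) : F.cell M s ⊆ F.cell M [] := by
  induction s with
  | nil => exact subset_rfl
  | cons i s ih => exact (F.cell_cons_subset i s).trans ih

/-- By `hasSum_mass` the left ends of the subcells increase to the right end of the parent. The
subcell sought is the one before the first left end beyond `u`. -/
theorem exists_mem_cell {u : ℝ} {s : List ℕ} (h : u ∈ F.cell M s) :
    ∃ i, u ∈ F.cell M (i :: s) := by
  classical
  have h1 : Tendsto (fun i => F.left M (i :: s)) atTop (𝓝 (F.left M s + F.mass M s)) :=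
    (F.hasSum_mass s).tendsto_sum_nat.const_add _
  have h2 : ∃ i, u < F.left M (i :: s) := (h1.eventually (lt_mem_nhds h.2)).exists
  have h0 : Nat.find h2 ≠ 0 := fun h0 => by
    have := Nat.find_spec h2
    rw [h0] at this
    simp only [left, Finset.range_zero, Finset.sum_empty, add_zero] at this
    exact absurd h.1 (not_le.2 this)
  obtain ⟨i, hi⟩ := Nat.exists_eq_succ_of_ne_zero h0
  refine ⟨i, ?_⟩
  rw [cell_cons]
  refine ⟨not_lt.1 (Nat.find_min h2 (by omega)), ?_⟩
  have := Nat.find_spec h2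
  rwa [hi] at this

theorem path_eq {u : ℝ} {s : List ℕ} (h : u ∈ F.cell M s) : F.path M u s.length = s := by
  induction s with
  | nil => rfl
  | cons i s ih =>
    rw [List.length_cons, path, ih (F.cell_cons_subset i s h), F.step_eq h]

theorem mem_cell_path {u : ℝ} (h : u ∈ Set.Ico 0 (M.real Set.univ)) (k : ℕ) :
    u ∈ F.cell M (F.path M u k) := by
  induction k with
  | zero => rw [path, cell_nil]; exact h
  | succ k ih =>
    obtain ⟨i, hi⟩ := F.exists_mem_cell ih
    rw [path, F.step_eq hi]
    exact hi

/-- A cell that contains a point has positive length, so its weight is nonzero at some `y`, and `y`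
is close to both centres. -/
theorem dist_point_point_lt {u : ℝ} (h : u ∈ Set.Ico 0 (M.real Set.univ)) (k l : ℕ) :
    dist (F.point M u k) (F.point M u l) < (1 / 2) ^ k + (1 / 2) ^ l := by
  have h1 := F.mem_cell_path h (max k l + 1)
  have h2 : F.mass M (F.path M u (max k l + 1)) ≠ 0 := by
    intro h0
    rw [cell, h0, add_zero, Set.Ico_self] at h1
    exact h1
  obtain ⟨y, hy⟩ : ∃ y, F.weight (F.path M u (max k l + 1)) y ≠ 0 := by
    by_contra! hc
    exact h2 (by simp [mass, hc])
  have h3 := F.dist_point_lt_of_weight_ne_zero hy (k := k) (by omega)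
  have h4 := F.dist_point_lt_of_weight_ne_zero hy (k := l) (by omega)
  have := dist_triangle_left (F.point M u k) (F.point M u l) y
  linarith

variable [CompleteSpace S]

theorem tendsto_point {u : ℝ} (h : u ∈ Set.Ico 0 (M.real Set.univ)) :
    Tendsto (F.point M u) atTop (𝓝 (F.repr M u)) := by
  have hc : CauchySeq (F.point M u) := by
    refine cauchySeq_of_le_geometric (1 / 2) 2 (by norm_num) fun k => ?_
    have := F.dist_point_point_lt h k (k + 1)
    rw [pow_succ] at this
    have h0 : (0 : ℝ) < (1 / 2) ^ k := by positivity
    linarith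
  rw [repr, if_pos h]
  exact hc.tendsto_limUnder

theorem dist_repr_point_le {u : ℝ} (h : u ∈ Set.Ico 0 (M.real Set.univ)) (k : ℕ) :
    dist (F.repr M u) (F.point M u k) ≤ (1 / 2) ^ k := by
  have h1 : Tendsto (fun l => dist (F.point M u l) (F.point M u k)) atTop
      (𝓝 (dist (F.repr M u) (F.point M u k))) := (F.tendsto_point h).dist tendsto_const_nhds
  have h2 : Tendsto (fun l : ℕ => ((1 / 2 : ℝ)) ^ l + (1 / 2) ^ k) atTop
      (𝓝 (0 + (1 / 2) ^ k)) :=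
    (tendsto_pow_atTop_nhds_zero_of_lt_one (by norm_num) (by norm_num)).add_const _
  rw [zero_add] at h2
  exact le_of_tendsto_of_tendsto' h1 h2 fun l => (F.dist_point_point_lt h l k).le

variable (M) in
theorem measurable_repr : Measurable (F.repr M) := by
  classical
  refine measurable_of_tendsto_metrizable
    (f := fun k u => if u ∈ Set.Ico 0 (M.real Set.univ) then F.point M u k else x 0)
    (fun k => Measurable.ite measurableSet_Ico (F.measurable_point M k) measurable_const) ?_
  rw [tendsto_pi_nhds]
  intro u
  by_cases h : u ∈ Set.Ico 0 (M.real Set.univ)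
  · simpa only [if_pos h] using F.tendsto_point h
  · simp only [repr, if_neg h]
    exact tendsto_const_nhds

/-- Here `m` counts the levels from `s` down to level `k + 1`. At that level the support of the
weight and the values of `repr` on the cell are both within `(1 / 2) ^ k` of one centre, so if some
value lies in `C`, the whole support lies in the thickening. Higher levels follow by summation over
subcells. -/
theorem volume_cell_inter_le (C : Set S) (k m : ℕ) (s : List ℕ) (hs : s.length + m = k + 1) :
    volume (F.cell M s ∩ F.repr M ⁻¹' C) ≤
      ∫⁻ y in Metric.cthickening (2 * (1 / 2) ^ k) C, ENNReal.ofReal (F.weight s y) ∂M := by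
  induction m generalizing s with
  | zero =>
    rcases (F.cell M s ∩ F.repr M ⁻¹' C).eq_empty_or_nonempty with h | ⟨u, hu, huC⟩
    · simp [h]
    have hI : u ∈ Set.Ico 0 (M.real Set.univ) := by
      rw [← F.cell_nil]
      exact F.cell_subset_cell_nil s hu
    have hp : F.path M u (k + 1) = s := by
      rw [← hs, add_zero]
      exact F.path_eq hu
    have hsupp : Function.support (fun y => ENNReal.ofReal (F.weight s y)) ⊆
        Metric.cthickening (2 * (1 / 2) ^ k) C := by
      intro y hy
      have hy' : F.weight (F.path M u (k + 1)) y ≠ 0 := by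
        rw [hp]
        intro h0
        exact hy (by simp [h0])
      have h1 := F.dist_point_lt_of_weight_ne_zero hy' k.lt_succ_self
      have h2 := F.dist_repr_point_le hI k
      refine Metric.mem_cthickening_of_dist_le y (F.repr M u) _ _ huC ?_
      have := dist_triangle_right y (F.repr M u) (F.point M u k)
      linarith
    rw [setLIntegral_eq_of_support_subset hsupp,
      ← ofReal_integral_eq_lintegral_ofReal (F.integrable_weight s) (ae_of_all _ (F.weight_nonneg s))]
    calc _ ≤ volume (F.cell M s) := measure_mono Set.inter_subset_left
      _ = _ := by rw [cell, Real.volume_Ico, add_sub_cancel_left, mass]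
  | succ m ih =>
    have hsub : F.cell M s ∩ F.repr M ⁻¹' C ⊆ ⋃ i, F.cell M (i :: s) ∩ F.repr M ⁻¹' C := by
      rintro u ⟨h1, h2⟩
      obtain ⟨i, hi⟩ := F.exists_mem_cell h1
      exact Set.mem_iUnion.2 ⟨i, hi, h2⟩
    calc _ ≤ ∑' i, volume (F.cell M (i :: s) ∩ F.repr M ⁻¹' C) :=
          (measure_mono hsub).trans (measure_iUnion_le _)
      _ ≤ ∑' i, ∫⁻ y in Metric.cthickening (2 * (1 / 2) ^ k) C,
            ENNReal.ofReal (F.weight (i :: s) y) ∂M :=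
          ENNReal.tsum_le_tsum fun i => ih (i :: s) (by simp; omega)
      _ = _ := by
        rw [← lintegral_tsum fun i =>
          (F.weight (i :: s)).continuous.measurable.ennreal_ofReal.aemeasurable]
        refine lintegral_congr fun y => ?_
        rw [← ENNReal.ofReal_tsum_of_nonneg (fun i => F.weight_nonneg _ y)
          (F.hasSum_weight s y).summable, (F.hasSum_weight s y).tsum_eq]

end PartitionSeq

/-- Finite measures with the same total mass are equal if one is at most the other on closed
sets. -/
theorem MeasureTheory.Measure.eq_of_forall_isClosed_le {S : Type*} [MetricSpace S]
    [MeasurableSpace S] [BorelSpace S] {μ ν : Measure S} [IsFiniteMeasure μ] [IsFiniteMeasure ν]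
    (h : ∀ C, IsClosed C → μ C ≤ ν C) (huniv : μ Set.univ = ν Set.univ) : μ = ν := by
  refine Measure.eq_of_le_of_measure_univ_eq (Measure.le_iff.2 fun A hA => ?_) huniv
  rw [hA.measure_eq_iSup_isClosed_of_ne_top (measure_ne_top μ A)]
  exact iSup₂_le fun C hC => iSup_le fun hcl => (h C hcl).trans (measure_mono hC)

namespace PartitionSeq

variable {S : Type*} [MetricSpace S] {x : ℕ → S} (F : PartitionSeq x)
  [MeasurableSpace S] [BorelSpace S] {M : Measure S} [IsFiniteMeasure M] [CompleteSpace S]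

variable (M) in
-- The cell estimate at the root, as the thickenings shrink to a closed set, gives one inequality on
-- closed sets. Equality of total masses does the rest.
theorem map_repr :
    (volume.restrict (Set.Ico 0 (M.real Set.univ))).map (F.repr M) = M := by
  refine Measure.eq_of_forall_isClosed_le (fun C hC => ?_) ?_
  · rw [Measure.map_apply (F.measurable_repr M) hC.measurableSet,
      Measure.restrict_apply (F.measurable_repr M hC.measurableSet), Set.inter_comm]
    have h1 : ∀ k : ℕ, volume (Set.Ico 0 (M.real Set.univ) ∩ F.repr M ⁻¹' C) ≤
        M (Metric.cthickening (2 * (1 / 2) ^ k) C) := by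
      intro k
      have := F.volume_cell_inter_le (M := M) C k (k + 1) [] (by simp)
      simpa [cell_nil, weight] using this
    have h2 : Tendsto (fun k : ℕ => (2 * (1 / 2) ^ k : ℝ)) atTop (𝓝 0) := by
      simpa using (tendsto_pow_atTop_nhds_zero_of_lt_one (r := (1 / 2 : ℝ)) (by norm_num)
        (by norm_num)).const_mul 2
    have h3 := (tendsto_measure_cthickening_of_isClosed (μ := M)
      ⟨1, one_pos, measure_ne_top M _⟩ hC).comp h2
    exact ge_of_tendsto' h3 h1
  · rw [Measure.map_apply (F.measurable_repr M) MeasurableSet.univ]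
    simp [measureReal_def]

/-- The representation is jointly continuous in the measure and in the point, off the ends of
the cells. -/
theorem tendsto_repr {ι : Type*} {l : Filter ι} {Mi : ι → Measure S}
    [∀ i, IsFiniteMeasure (Mi i)]
    (hM : ∀ f : S →ᵇ ℝ, Tendsto (fun i => ∫ y, f y ∂Mi i) l (𝓝 (∫ y, f y ∂M)))
    {ui : ι → ℝ} {u : ℝ} (hu : Tendsto ui l (𝓝 u)) (h : u ∈ Set.Ico 0 (M.real Set.univ))
    (hne : ∀ s, u ≠ F.left M s) :
    Tendsto (fun i => F.repr (Mi i) (ui i)) l (𝓝 (F.repr M u)) := by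
  have hmass : ∀ s, Tendsto (fun i => F.mass (Mi i) s) l (𝓝 (F.mass M s)) := fun s => hM _
  have hleft : ∀ s, Tendsto (fun i => F.left (Mi i) s) l (𝓝 (F.left M s)) := by
    intro s
    induction s with
    | nil => exact tendsto_const_nhds
    | cons i s ih => exact ih.add (tendsto_finsetSum _ fun j _ => hmass _)
  -- The ends of a cell are finite sums of integrals of bounded continuous functions, hence move
  -- continuously. Only left ends have to be excluded because cells are half-open.
  have hcell : ∀ s, u ∈ F.cell M s → ∀ᶠ i in l, ui i ∈ F.cell (Mi i) s := by
    intro s hs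
    filter_upwards [(hleft s).eventually_lt hu (lt_of_le_of_ne hs.1 (hne s).symm),
      hu.eventually_lt ((hleft s).add (hmass s)) hs.2] with i h1 h2
    exact ⟨h1.le, h2⟩
  rw [Metric.tendsto_nhds]
  intro ε hε
  obtain ⟨k, hk⟩ := exists_pow_lt_of_lt_one (half_pos hε) (show (1 / 2 : ℝ) < 1 by norm_num)
  filter_upwards [hcell _ (F.mem_cell_path h (k + 1)), hcell _ (F.mem_cell_path h 0)]
    with i h1 h2
  have hp := F.path_eq h1
  rw [length_path] at hp
  rw [path, cell_nil] at h2
  have h3 := F.dist_repr_point_le h2 k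
  have h4 := F.dist_repr_point_le h k
  rw [point_eq_headI] at h3 h4
  rw [hp] at h3
  have := dist_triangle_right (F.repr (Mi i) (ui i)) (F.repr M u)
    (x (F.path M u (k + 1)).headI)
  linarith

end PartitionSeq

/-! ### Diffuse random variables on nonatomic spaces -/

section Nonatomic

variable {Ω : Type*} [MeasurableSpace Ω] {P : Measure Ω} [IsFiniteMeasure P]

theorem Nonatomic.exists_subset_half (hP : Nonatomic P) {A : Set Ω} (hA : MeasurableSet A)
    (h : 0 < P A) : ∃ B, MeasurableSet B ∧ B ⊆ A ∧ 0 < P B ∧ 2 * P B ≤ P A := by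
  obtain ⟨B, hB, hBA, h0, hlt⟩ := hP A hA h
  have hd : P (A \ B) = P A - P B := measure_sdiff hBA hB.nullMeasurableSet (measure_ne_top P B)
  have hadd : P B + P (A \ B) = P A := by rw [hd, add_tsub_cancel_of_le hlt.le]
  rcases le_total (P B) (P (A \ B)) with hle | hle
  · refine ⟨B, hB, hBA, h0, ?_⟩
    rw [two_mul, ← hadd]
    gcongr
  · refine ⟨A \ B, hA.diff hB, Set.sdiff_subset, by rw [hd]; exact tsub_pos_of_lt hlt, ?_⟩
    rw [two_mul, ← hadd]
    gcongr

theorem Nonatomic.exists_subset_le (hP : Nonatomic P) {A : Set Ω} (hA : MeasurableSet A)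
    (h : 0 < P A) {ε : ENNReal} (hε : 0 < ε) :
    ∃ B, MeasurableSet B ∧ B ⊆ A ∧ 0 < P B ∧ P B ≤ ε := by
  have key : ∀ n : ℕ, ∃ B, MeasurableSet B ∧ B ⊆ A ∧ 0 < P B ∧ 2 ^ n * P B ≤ P A := by
    intro n
    induction n with
    | zero => exact ⟨A, hA, subset_rfl, h, by simp⟩
    | succ n ih =>
      obtain ⟨B, hB, hBA, h0, hle⟩ := ih
      obtain ⟨C, hC, hCB, hC0, hC2⟩ := hP.exists_subset_half hB h0
      refine ⟨C, hC, hCB.trans hBA, hC0, ?_⟩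
      calc _ = 2 ^ n * (2 * P C) := by ring
        _ ≤ 2 ^ n * P B := by gcongr
        _ ≤ P A := hle
  by_cases hεt : ε = ⊤
  · exact ⟨A, hA, subset_rfl, h, by simp [hεt]⟩
  obtain ⟨n, hn⟩ := ENNReal.exists_nat_gt (ENNReal.div_ne_top (measure_ne_top P A) hε.ne')
  obtain ⟨B, hB, hBA, h0, hle⟩ := key n
  refine ⟨B, hB, hBA, h0, ?_⟩
  have h1 : P A ≤ 2 ^ n * ε := by
    rw [ENNReal.div_lt_iff (Or.inl hε.ne') (Or.inl hεt)] at hn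
    refine hn.le.trans ?_
    gcongr
    exact_mod_cast Nat.lt_two_pow_self.le
  exact (ENNReal.mul_le_mul_iff_right (by positivity) (by finiteness)).1 (hle.trans h1)

/-- Exhaustion: among countable unions of sets of measure at most `ε` one has maximal measure. Its
complement is null, since otherwise it would contain a further small set of positive measure. -/
theorem Nonatomic.exists_partition (hP : Nonatomic P) {ε : ENNReal} (hε : 0 < ε) :
    ∃ L : Ω → ℕ, Measurable L ∧ ∀ i, P (L ⁻¹' {i}) ≤ ε := by
  classical
  let K : Set (Set Ω) := {A | ∃ B : ℕ → Set Ω, (∀ n, MeasurableSet (B n) ∧ P (B n) ≤ ε) ∧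
    A = ⋃ n, B n}
  have hK : ∀ A ∈ K, MeasurableSet A := by
    rintro _ ⟨B, hB, rfl⟩
    exact MeasurableSet.iUnion fun n => (hB n).1
  have hUnion : ∀ A : ℕ → Set Ω, (∀ n, A n ∈ K) → (⋃ n, A n) ∈ K := by
    intro A hA
    choose B hB hAB using hA
    refine ⟨fun n => B n.unpair.1 n.unpair.2, fun n => hB _ _, ?_⟩
    rw [Set.iUnion_unpair B]
    simp_rw [hAB]
  have hne : K.Nonempty := ⟨∅, fun _ => ∅, fun _ => by simp, by simp⟩
  obtain ⟨u, -, hu, huK⟩ := exists_seq_tendsto_sSup (hne.image P) (OrderTop.bddAbove _)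
  choose A hAK hAu using huK
  have hmem := hUnion A hAK
  obtain ⟨B, hB, hAB⟩ := id hmem
  have hsup : ∀ C ∈ K, P C ≤ P (⋃ n, A n) := by
    intro C hC
    refine (le_sSup (Set.mem_image_of_mem P hC)).trans (le_of_tendsto' hu fun n => ?_)
    rw [← hAu]
    exact measure_mono (Set.subset_iUnion A n)
  have hnull : P (⋃ n, A n)ᶜ = 0 := by
    by_contra h0
    obtain ⟨C, hC, hCA, hC0, hCε⟩ :=
      hP.exists_subset_le (hK _ hmem).compl (pos_iff_ne_zero.2 h0) hε
    have hCK : C ∈ K := ⟨fun _ => C, fun _ => ⟨hC, hCε⟩, (Set.iUnion_const C).symm⟩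
    have hle := hsup _ (hUnion (fun n => if n = 0 then C else ⋃ n, A n) fun n => by
      split_ifs
      exacts [hCK, hmem])
    have hsub : (⋃ n, A n) ∪ C ⊆ ⋃ n : ℕ, if n = 0 then C else ⋃ n, A n := by
      rintro ω (h | h)
      · exact Set.mem_iUnion.2 ⟨1, by simpa using h⟩
      · exact Set.mem_iUnion.2 ⟨0, by simpa using h⟩
    have hd : Disjoint (⋃ n, A n) C :=
      Set.disjoint_left.2 fun ω h h' => hCA h' h
    have := (measure_mono hsub).trans hle
    rw [measure_union hd hC] at this
    exact absurd (ENNReal.lt_add_right (measure_ne_top P _) hC0.ne') (not_lt.2 this)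
  rw [hAB] at hnull
  -- The second alternative sends the null remainder to the fibre of `0`.
  have hdec : ∀ ω, ∃ n, ω ∈ B n ∨ ω ∉ ⋃ n, B n := by
    intro ω
    by_cases h : ω ∈ ⋃ n, B n
    · obtain ⟨n, hn⟩ := Set.mem_iUnion.1 h
      exact ⟨n, Or.inl hn⟩
    · exact ⟨0, Or.inr h⟩
  refine ⟨fun ω => Nat.find (hdec ω), measurable_find hdec fun n =>
    (hB n).1.union (MeasurableSet.iUnion fun n => (hB n).1).compl, fun i => ?_⟩
  have hsub : (fun ω => Nat.find (hdec ω)) ⁻¹' {i} ⊆ B i ∪ (⋃ n, B n)ᶜ := by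
    rintro ω rfl
    exact Nat.find_spec (hdec ω)
  calc _ ≤ P (B i) + P (⋃ n, B n)ᶜ := (measure_mono hsub).trans (measure_union_le _ _)
    _ ≤ ε := by rw [hnull, add_zero]; exact (hB i).2

/-- A nonatomic measure admits a random variable in `(0, 1)` without atoms. -/
theorem Nonatomic.exists_diffuse (hP : Nonatomic P) :
    ∃ U : Ω → ℝ, Measurable U ∧ (∀ ω, U ω ∈ Set.Ioo (0 : ℝ) 1) ∧ ∀ u, P (U ⁻¹' {u}) = 0 := by
  -- A fibre of the sequence of all labels lies in a fibre of each `L n`, so it is null. A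
  -- measurable embedding into the line followed by an injective map into `(0, 1)` creates no larger
  -- fibres.
  choose L hL hLP using fun n : ℕ =>
    hP.exists_partition (ε := ((n : ENNReal) + 1)⁻¹) (by simp)
  obtain ⟨e, he⟩ := exists_measurableEmbedding_real (ℕ → ℕ)
  have hLm : Measurable fun ω n => L n ω := measurable_pi_lambda _ hL
  have hinj : Function.Injective fun y : ℝ => (1 + Real.exp y)⁻¹ := by
    intro a b h
    have := inv_injective h
    exact Real.exp_injective (add_left_cancel this)
  refine ⟨fun ω => (1 + Real.exp (e fun n => L n ω))⁻¹, ?_, fun ω => ?_, fun u => ?_⟩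
  · exact ((Real.measurable_exp.comp (he.measurable.comp hLm)).const_add 1).inv
  · have := Real.exp_pos (e fun n => L n ω)
    exact ⟨by positivity, inv_lt_one_of_one_lt₀ (by linarith)⟩
  · rcases ((fun ω => (1 + Real.exp (e fun n => L n ω))⁻¹) ⁻¹' {u}).eq_empty_or_nonempty
      with h | ⟨ω₀, hω₀⟩
    · rw [h, measure_empty]
    have hsub : ∀ n, (fun ω => (1 + Real.exp (e fun n => L n ω))⁻¹) ⁻¹' {u} ⊆
        L n ⁻¹' {L n ω₀} := by
      intro n ω hω
      have h1 : (1 + Real.exp (e fun n => L n ω))⁻¹ = (1 + Real.exp (e fun n => L n ω₀))⁻¹ :=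
        Eq.trans hω (Eq.symm hω₀)
      exact congrFun (he.injective (hinj h1)) n
    refine le_antisymm (ge_of_tendsto' (x := atTop) ?_ fun n : ℕ =>
      (measure_mono (hsub n)).trans (hLP n _)) zero_le
    have := ENNReal.tendsto_inv_nat_nhds_zero.comp (tendsto_add_atTop_nat 1)
    simpa [Function.comp_def] using this

end Nonatomic

/-! ### The probability integral transform -/

section ProbabilityIntegralTransform

variable {ν : Measure ℝ} [IsFiniteMeasure ν]

/-- Dominated convergence: the indicator of `Set.Iio v` at `w` is continuous in `v` at `u` unless `w
= u`, which is a null event. -/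
theorem continuous_measureReal_Iio (h0 : ∀ u, ν {u} = 0) :
    Continuous fun u => ν.real (Set.Iio u) := by
  have heq : ∀ u, ν.real (Set.Iio u) = ∫ v, (Set.Iio u).indicator 1 v ∂ν := fun u =>
    (integral_indicator_one measurableSet_Iio).symm
  simp_rw [heq]
  refine continuous_iff_continuousAt.2 fun u => continuousAt_of_dominated (bound := 1)
    (Eventually.of_forall fun v => ?_) (Eventually.of_forall fun v => ae_of_all _ fun w => ?_)
    (integrable_const 1) ?_
  · exact (measurable_one.indicator measurableSet_Iio).aestronglyMeasurable
  · by_cases h : w < v <;> simp [Set.indicator, h]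
  · have : ∀ᵐ w ∂ν, w ≠ u := by
      rw [ae_iff]
      simpa using h0 u
    filter_upwards [this] with w hw
    rcases lt_or_gt_of_ne hw with h | h
    · refine (continuousAt_const (y := (1 : ℝ))).congr ?_
      filter_upwards [lt_mem_nhds h] with v hv
      simp [hv]
    · refine (continuousAt_const (y := (0 : ℝ))).congr ?_
      filter_upwards [gt_mem_nhds h] with v hv
      simp [hv.le]

/-- The probability integral transform. -/
theorem map_measureReal_Iio (h0 : ∀ u, ν {u} = 0) :
    ν.map (fun u => ν.real (Set.Iio u)) = volume.restrict (Set.Ico 0 (ν.real Set.univ)) := by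
  have hcont := continuous_measureReal_Iio h0
  have hmono : Monotone fun u => ν.real (Set.Iio u) := fun u v h =>
    measureReal_mono (Set.Iio_subset_Iio h)
  have hsurj : ∀ c, 0 < c → c < ν.real Set.univ → ∃ u, ν.real (Set.Iio u) = c := by
    intro c hc hc'
    have hbot : Tendsto (fun u => ν.real (Set.Iio u)) atBot (𝓝 0) := by
      have := ((ENNReal.tendsto_toReal (measure_ne_top ν _)).comp
        (tendsto_measure_Ici_atBot ν)).const_sub (ν.real Set.univ)
      rw [← measureReal_def, sub_self] at this
      refine this.congr fun u => ?_
      rw [← Set.compl_Ici, measureReal_compl measurableSet_Ici]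
      rfl
    -- The shift by `1` makes `Set.Iic (u - 1)` a subset of `Set.Iio u`.
    have htop : Tendsto (fun u => ν.real (Set.Iic (u - 1))) atTop (𝓝 (ν.real Set.univ)) :=
      ((ENNReal.tendsto_toReal (measure_ne_top ν _)).comp (tendsto_measure_Iic_atTop ν)).comp
        (tendsto_atTop_add_const_right _ (-1) tendsto_id)
    obtain ⟨a, ha⟩ := (hbot.eventually (gt_mem_nhds hc)).exists
    obtain ⟨b, hb⟩ := (htop.eventually (lt_mem_nhds hc')).exists
    refine mem_range_of_exists_le_of_exists_ge hcont ⟨a, ha.le⟩ ⟨b, hb.le.trans ?_⟩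
    exact measureReal_mono fun x (hx : x ≤ b - 1) => show x < b by linarith
  have hof : ∀ s, ν s = ENNReal.ofReal (ν.real s) := fun s => (ofReal_measureReal).symm
  refine Measure.ext_of_Iic _ _ fun c => ?_
  rw [Measure.map_apply hcont.measurable measurableSet_Iic,
    Measure.restrict_apply measurableSet_Iic]
  rcases lt_or_ge c 0 with hc | hc
  · have h1 : (fun u => ν.real (Set.Iio u)) ⁻¹' Set.Iic c = ∅ := by
      ext u
      simpa using hc.trans_le measureReal_nonneg
    have h2 : Set.Iic c ∩ Set.Ico 0 (ν.real Set.univ) = ∅ := by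
      ext u
      simp only [Set.mem_inter_iff, Set.mem_Iic, Set.mem_Ico, Set.mem_empty_iff_false, iff_false]
      intro h
      linarith [h.1, h.2.1]
    rw [h1, h2, measure_empty, measure_empty]
  rcases lt_or_ge c (ν.real Set.univ) with hcm | hcm
  · have h2 : Set.Iic c ∩ Set.Ico 0 (ν.real Set.univ) = Set.Icc 0 c := by
      ext u
      simp only [Set.mem_inter_iff, Set.mem_Iic, Set.mem_Ico, Set.mem_Icc]
      exact ⟨fun h => ⟨h.2.1, h.1⟩, fun h => ⟨h.2, h.1, h.2.trans_lt hcm⟩⟩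
    rw [h2, Real.volume_Icc, sub_zero, hof]
    congr 1
    -- The distribution function may have flat pieces, so its sublevel set is squeezed between
    -- half-lines: from outside at points where it takes a value `c' > c`, from inside at a point
    -- where it equals `c`.
    refine le_antisymm (le_of_forall_gt_imp_ge_of_dense fun c' hc' => ?_) ?_
    · rcases lt_or_ge c' (ν.real Set.univ) with h | h
      · obtain ⟨u, hu⟩ := hsurj c' (hc.trans_lt hc') h
        rw [← hu]
        refine measureReal_mono fun v (hv : _ ≤ c) => ?_
        by_contra hn
        linarith [hmono (not_lt.1 hn)]
      · exact (measureReal_mono (Set.subset_univ _)).trans h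
    · rcases hc.eq_or_lt with rfl | hc
      · exact measureReal_nonneg
      · obtain ⟨u, hu⟩ := hsurj c hc hcm
        rw [← hu]
        exact measureReal_mono fun v hv => hmono (le_of_lt hv)
  · have h1 : (fun u => ν.real (Set.Iio u)) ⁻¹' Set.Iic c = Set.univ := by
      ext u
      simpa using (measureReal_mono (Set.subset_univ _)).trans hcm
    have h2 : Set.Iic c ∩ Set.Ico 0 (ν.real Set.univ) = Set.Ico 0 (ν.real Set.univ) :=
      Set.inter_eq_right.2 fun u hu => hu.2.le.trans hcm
    rw [h1, h2, Real.volume_Ico, sub_zero, ← hof]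

end ProbabilityIntegralTransform

/-! ### Slots cut out by the diffuse variable -/

section Slot

variable {Ω V : Type*} [MeasurableSpace Ω]

/-- The event that the label `D j` is `i`, while `U` is between the cut points `Λ j` and
`Λ (j + 1)`. -/
def slot (U : Ω → ℝ) (Λ : ℕ → V → ℝ) (D : ℕ → Ω → ℕ) (t : V) (l : ℕ × ℕ) : Set Ω :=
  {ω | D l.1 ω = l.2 ∧ Λ l.1 t ≤ U ω ∧ U ω < Λ (l.1 + 1) t}

/-- The distribution of `U` on an event. -/
noncomputable def lawOn (P : Measure Ω) (U : Ω → ℝ) (A : Set Ω) : Measure ℝ :=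
  (P.restrict A).map U

variable {P : Measure Ω} {U : Ω → ℝ}

instance [IsFiniteMeasure P] (A : Set Ω) : IsFiniteMeasure (lawOn P U A) := by
  unfold lawOn
  infer_instance

theorem lawOn_apply (hU : Measurable U) {A : Set Ω} {C : Set ℝ} (hC : MeasurableSet C) :
    lawOn P U A C = P (A ∩ U ⁻¹' C) := by
  rw [lawOn, Measure.map_apply hU hC, Measure.restrict_apply (hU hC), Set.inter_comm]

theorem lawOn_real_apply (hU : Measurable U) {A : Set Ω} {C : Set ℝ} (hC : MeasurableSet C) :
    (lawOn P U A).real C = P.real (A ∩ U ⁻¹' C) := by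
  rw [measureReal_def, lawOn_apply hU hC, measureReal_def]

theorem lawOn_singleton (hU : Measurable U) (hU0 : ∀ u, P (U ⁻¹' {u}) = 0) (A : Set Ω) (u : ℝ) :
    lawOn P U A {u} = 0 := by
  rw [lawOn_apply hU (measurableSet_singleton u)]
  exact measure_mono_null Set.inter_subset_right (hU0 u)

variable [IsFiniteMeasure P] {Λ : ℕ → V → ℝ} {D : ℕ → Ω → ℕ}

theorem measurableSet_slot (hU : Measurable U) (hD : ∀ j, Measurable (D j)) (t : V) (l : ℕ × ℕ) :
    MeasurableSet (slot U Λ D t l) :=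
  (hD l.1 (measurableSet_singleton l.2)).inter
    ((measurableSet_le measurable_const hU).inter (measurableSet_lt hU measurable_const))

/-- The label event does not depend on `t`, so the parameter enters only through the cut points. All
continuity in `t` comes from this formula. -/
theorem measureReal_slot_inter_Iio (hU : Measurable U) (hD : ∀ j, Measurable (D j)) {t : V}
    {l : ℕ × ℕ} {u : ℝ} (h1 : Λ l.1 t ≤ u) (h2 : u ≤ Λ (l.1 + 1) t) :
    (lawOn P U (slot U Λ D t l)).real (Set.Iio u) =
      (lawOn P U {ω | D l.1 ω = l.2}).real (Set.Iio u) -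
        (lawOn P U {ω | D l.1 ω = l.2}).real (Set.Iio (Λ l.1 t)) := by
  have hm : MeasurableSet {ω | D l.1 ω = l.2} := hD l.1 (measurableSet_singleton l.2)
  simp only [lawOn_real_apply hU measurableSet_Iio]
  have hsub : {ω | D l.1 ω = l.2} ∩ U ⁻¹' Set.Iio (Λ l.1 t) ⊆
      {ω | D l.1 ω = l.2} ∩ U ⁻¹' Set.Iio u := fun ω hω =>
    ⟨hω.1, lt_of_lt_of_le (show U ω < Λ l.1 t from hω.2) h1⟩
  rw [← measureReal_sdiff hsub (hm.inter (hU measurableSet_Iio))]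
  congr 1
  ext ω
  simp only [slot, Set.mem_inter_iff, Set.mem_ofPred_eq, Set.mem_preimage, Set.mem_Iio,
    Set.mem_sdiff, not_and, not_lt]
  exact ⟨fun h => ⟨⟨h.1.1, h.2⟩, fun _ => h.1.2.1⟩,
    fun h => ⟨⟨h.1.1, h.2 h.1.1, h.1.2.trans_le h2⟩, h.1.2⟩⟩

theorem continuous_measureReal_slot [TopologicalSpace V] (hU : Measurable U)
    (hU0 : ∀ u, P (U ⁻¹' {u}) = 0) (hD : ∀ j, Measurable (D j)) (hΛ : ∀ j, Continuous (Λ j))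
    (hΛmono : ∀ t, Monotone fun j => Λ j t) (l : ℕ × ℕ) :
    Continuous fun t => P.real (slot U Λ D t l) := by
  have h : ∀ t, P.real (slot U Λ D t l) =
      (lawOn P U {ω | D l.1 ω = l.2}).real (Set.Iio (Λ (l.1 + 1) t)) -
        (lawOn P U {ω | D l.1 ω = l.2}).real (Set.Iio (Λ l.1 t)) := by
    intro t
    rw [← measureReal_slot_inter_Iio hU hD (hΛmono t (Nat.le_succ _)) le_rfl,
      lawOn_real_apply hU measurableSet_Iio, Set.inter_eq_left.2]
    exact fun ω hω => hω.2.2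
  have hc := continuous_measureReal_Iio (lawOn_singleton hU hU0 {ω | D l.1 ω = l.2})
  simp_rw [h]
  exact (hc.comp (hΛ _)).sub (hc.comp (hΛ _))

theorem exists_index {Ω V : Type*} {U : Ω → ℝ} {Λ : ℕ → V → ℝ} (hU1 : ∀ ω, U ω < 1) {t : V}
    (hΛ1 : Tendsto (fun j => Λ j t) atTop (𝓝 1)) (ω : Ω) : ∃ j, U ω < Λ (j + 1) t :=
  ((hΛ1.comp (tendsto_add_atTop_nat 1)).eventually (lt_mem_nhds (hU1 ω))).exists

/-- The index is the first `j` with `U ω < Λ (j + 1) t`. Monotone cut points make the windows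
disjoint, and their limits `0` and `1` make them exhaust the range of `U`. -/
theorem exists_label {Ω V : Type*} {U : Ω → ℝ} {Λ : ℕ → V → ℝ} {D : ℕ → Ω → ℕ} (hU01 : ∀ ω, U ω ∈ Set.Ioo (0 : ℝ) 1) (hΛ0 : ∀ t, Λ 0 t = 0)
    (hΛmono : ∀ t, Monotone fun j => Λ j t)
    (hΛ1 : ∀ t, Tendsto (fun j => Λ j t) atTop (𝓝 1)) :
    ∃ L : V → Ω → ℕ × ℕ, ∀ t ω l, ω ∈ slot U Λ D t l ↔ L t ω = l := by
  classical
  have hex := fun t => exists_index (U := U) (fun ω => (hU01 ω).2) (hΛ1 t)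
  refine ⟨fun t ω => (Nat.find (hex t ω), D (Nat.find (hex t ω)) ω), fun t ω l => ⟨?_, ?_⟩⟩
  · rintro ⟨h1, h2, h3⟩
    have : Nat.find (hex t ω) = l.1 := by
      rw [Nat.find_eq_iff]
      exact ⟨h3, fun j hj => not_lt.2 ((hΛmono t hj).trans h2)⟩
    exact Prod.ext this (by dsimp only; rw [this, h1])
  · rintro rfl
    refine ⟨rfl, ?_, Nat.find_spec (hex t ω)⟩
    dsimp only
    rcases Nat.eq_zero_or_eq_succ_pred (Nat.find (hex t ω)) with h | h
    · rw [h, hΛ0]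
      exact (hU01 ω).1.le
    · rw [h]
      exact not_lt.1 (Nat.find_min (hex t ω) (by omega))

end Slot

/-! ### Realisation of measures on slots -/

theorem measurable_comp_countable {Ω ι S : Type*} [MeasurableSpace Ω] [MeasurableSpace ι]
    [Countable ι] [MeasurableSingletonClass ι] [MeasurableSpace S] {L : Ω → ι} (hL : Measurable L)
    {g : ι → Ω → S} (hg : ∀ l, Measurable (g l)) : Measurable fun ω => g (L ω) ω :=
  (measurable_from_prod_countable_right (f := fun q : ι × Ω => g q.1 q.2) hg).comp
    (hL.prodMk measurable_id)

/-- Random variables with prescribed conditional distributions on the slots, which depend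
continuously on the parameter. -/
theorem exists_continuous_of_slot_measures {S : Type*} [MetricSpace S] [CompleteSpace S]
    [SecondCountableTopology S] [MeasurableSpace S] [BorelSpace S] {x : ℕ → S}
    (hx : DenseRange x) {Ω : Type*} [MeasurableSpace Ω] {P : Measure Ω} [IsProbabilityMeasure P]
    {U : Ω → ℝ} (hU : Measurable U) (hU01 : ∀ ω, U ω ∈ Set.Ioo (0 : ℝ) 1)
    (hU0 : ∀ u, P (U ⁻¹' {u}) = 0)
    {V : Type*} [TopologicalSpace V] [FirstCountableTopology V]
    {Λ : ℕ → V → ℝ} (hΛ : ∀ j, Continuous (Λ j)) (hΛ0 : ∀ t, Λ 0 t = 0)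
    (hΛmono : ∀ t, Monotone fun j => Λ j t)
    (hΛ1 : ∀ t, Tendsto (fun j => Λ j t) atTop (𝓝 1))
    {D : ℕ → Ω → ℕ} (hD : ∀ j, Measurable (D j))
    (M : V → ℕ × ℕ → Measure S) [∀ t l, IsFiniteMeasure (M t l)]
    (hM : ∀ l (f : S →ᵇ ℝ), Continuous fun t => ∫ y, f y ∂M t l)
    (hMmass : ∀ t l, M t l Set.univ = P (slot U Λ D t l)) :
    ∃ Z : V → (Ω →ₘ[P] S), Continuous Z ∧
      ∀ t l C, MeasurableSet C → P (slot U Λ D t l ∩ Z t ⁻¹' C) = M t l C := by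
  obtain ⟨F⟩ := nonempty_partitionSeq hx
  obtain ⟨L, hL⟩ := exists_label (D := D) hU01 hΛ0 hΛmono hΛ1
  have hLm : ∀ t, Measurable (L t) := fun t => measurable_to_countable' fun l => by
    have : L t ⁻¹' {l} = slot U Λ D t l := by
      ext ω
      exact (hL t ω l).symm
    rw [this]
    exact measurableSet_slot hU hD t l
  have hν0 : ∀ t l u, lawOn P U (slot U Λ D t l) {u} = 0 := fun t l u =>
    lawOn_singleton hU hU0 _ u
  have hνuniv : ∀ t l, (lawOn P U (slot U Λ D t l)).real Set.univ = (M t l).real Set.univ := by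
    intro t l
    rw [lawOn_real_apply hU MeasurableSet.univ, measureReal_def, measureReal_def, hMmass]
    simp
  have hG : ∀ t l, Measurable fun u => (lawOn P U (slot U Λ D t l)).real (Set.Iio u) :=
    fun t l => (continuous_measureReal_Iio (hν0 t l)).measurable
  have hmap : ∀ t l, (P.restrict (slot U Λ D t l)).map
      (fun ω => (lawOn P U (slot U Λ D t l)).real (Set.Iio (U ω))) =
        volume.restrict (Set.Ico 0 ((M t l).real Set.univ)) := by
    intro t l
    rw [← hνuniv, ← map_measureReal_Iio (hν0 t l)]
    exact (Measure.map_map (hG t l) hU).symm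
  -- On each slot the distribution function of `U` restricted to the slot is uniform on an interval
  -- of length the mass of `M t l`, which is the domain where `repr` represents `M t l`.
  set z : V → Ω → S := fun t ω =>
    F.repr (M t (L t ω)) ((lawOn P U (slot U Λ D t (L t ω))).real (Set.Iio (U ω))) with hz
  have hzm : ∀ t, Measurable (z t) := by
    intro t
    have h1 : ∀ l, Measurable ((fun l ω =>
        F.repr (M t l) ((lawOn P U (slot U Λ D t l)).real (Set.Iio (U ω)))) l) := fun l =>
      (F.measurable_repr (M t l)).comp ((hG t l).comp hU)
    exact measurable_comp_countable (hLm t) h1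
  have hzs : ∀ t, AEStronglyMeasurable (z t) P := fun t => (hzm t).aestronglyMeasurable
  have hmk : ∀ t, (AEEqFun.mk (z t) (hzs t) : Ω → S) =ᵐ[P] z t := fun t =>
    AEEqFun.coeFn_mk _ _
  refine ⟨fun t => AEEqFun.mk (z t) (hzs t), ?_, fun t l C hC => ?_⟩
  · refine continuous_iff_continuousAt.2 fun t₀ => ?_
    have hae : ∀ᵐ ω ∂P, Tendsto (fun t => z t ω) (𝓝 t₀) (𝓝 (z t₀ ω)) := by
      have h1 : ∀ᵐ ω ∂P, ∀ j, U ω ≠ Λ j t₀ := ae_all_iff.2 fun j => by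
        rw [ae_iff]
        simp only [ne_eq, not_not]
        exact hU0 (Λ j t₀)
      -- The countably many left ends are Lebesgue null, and by `hmap` so are their preimages in the
      -- slot.
      have h2 : ∀ᵐ ω ∂P, ∀ l, ω ∈ slot U Λ D t₀ l →
          (lawOn P U (slot U Λ D t₀ l)).real (Set.Iio (U ω)) ∈
              Set.Ico 0 ((M t₀ l).real Set.univ) ∧
            ∀ s, (lawOn P U (slot U Λ D t₀ l)).real (Set.Iio (U ω)) ≠ F.left (M t₀ l) s := by
        refine ae_all_iff.2 fun l => ?_
        rw [← ae_restrict_iff' (measurableSet_slot hU hD t₀ l)]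
        have h3 : ∀ᵐ u ∂volume.restrict (Set.Ico 0 ((M t₀ l).real Set.univ)),
            u ∈ Set.Ico 0 ((M t₀ l).real Set.univ) ∧ ∀ s, u ≠ F.left (M t₀ l) s :=
          (ae_restrict_mem measurableSet_Ico).and
            (ae_all_iff.2 fun s => ae_restrict_of_ae (by simp [ae_iff]))
        rw [← hmap t₀ l] at h3
        exact ae_of_ae_map ((hG t₀ l).comp hU).aemeasurable h3
      filter_upwards [h1, h2] with ω hω1 hω2
      obtain ⟨l, hl⟩ : ∃ l, L t₀ ω = l := ⟨_, rfl⟩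
      have hslot := (hL t₀ ω l).2 hl
      obtain ⟨hI, hne⟩ := hω2 l hslot
      have hlt1 : Λ l.1 t₀ < U ω := lt_of_le_of_ne hslot.2.1 (hω1 _).symm
      have hev : ∀ᶠ t in 𝓝 t₀, Λ l.1 t < U ω ∧ U ω < Λ (l.1 + 1) t :=
        ((hΛ _).continuousAt.eventually (gt_mem_nhds hlt1)).and
          ((hΛ _).continuousAt.eventually (lt_mem_nhds hslot.2.2))
      have hcont : Tendsto (fun t => (lawOn P U (slot U Λ D t l)).real (Set.Iio (U ω))) (𝓝 t₀)
          (𝓝 ((lawOn P U (slot U Λ D t₀ l)).real (Set.Iio (U ω)))) := by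
        have hc := continuous_measureReal_Iio (lawOn_singleton hU hU0 {ω | D l.1 ω = l.2})
        rw [measureReal_slot_inter_Iio hU hD hlt1.le hslot.2.2.le]
        refine Tendsto.congr' ?_
          ((continuous_const.sub (hc.comp (hΛ l.1))).tendsto t₀)
        filter_upwards [hev] with t ht
        rw [measureReal_slot_inter_Iio hU hD ht.1.le ht.2.le]
        rfl
      have := F.tendsto_repr (fun f => (hM l f).tendsto t₀) hcont hI hne
      simp only [hz, hl]
      refine this.congr' ?_
      filter_upwards [hev] with t ht
      rw [(hL t ω l).1 ⟨hslot.1, ht.1.le, ht.2⟩]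
    -- Sequences are needed twice: almost sure convergence along a sequence implies convergence in
    -- probability, and only countably many null sets from the choice of representatives may be
    -- discarded.
    refine tendsto_of_seq_tendsto fun u hu => ?_
    rw [L0.tendsto_iff_tendstoInMeasure]
    refine tendstoInMeasure_of_tendsto_ae (fun n => (AEEqFun.aestronglyMeasurable _)) ?_
    filter_upwards [hae, ae_all_iff.2 fun n => hmk (u n), hmk t₀] with ω h1 h2 h3
    rw [h3]
    exact (h1.comp hu).congr fun n => (h2 n).symm
  · have h1 : P (slot U Λ D t l ∩ (AEEqFun.mk (z t) (hzs t) : Ω → S) ⁻¹' C) =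
        P (slot U Λ D t l ∩ (fun ω => (lawOn P U (slot U Λ D t l)).real (Set.Iio (U ω))) ⁻¹'
          (F.repr (M t l) ⁻¹' C)) := by
      refine measure_congr ?_
      filter_upwards [hmk t] with ω hω
      refine propext (and_congr_right fun h => ?_)
      change _ ∈ C ↔ _ ∈ C
      rw [hω]
      simp only [hz, (hL t ω l).1 h]
    rw [h1, Set.inter_comm, ← Measure.restrict_apply, ← Measure.map_apply, hmap,
      ← Measure.map_apply (F.measurable_repr _) hC, F.map_repr]
    · exact (hG t l).comp hU
    · exact F.measurable_repr _ hC
    · exact (hG t l).comp hU (F.measurable_repr _ hC)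

/-! ### Continuous selection of splittings -/

section Selection

variable {S : Type*} [MetricSpace S] [MeasurableSpace S] [BorelSpace S]

/-- Replacing `h t` by `h t₀` costs at most their uniform distance, whatever the probability
measure. What remains is weak convergence. -/
theorem continuous_integral_of_continuous {V : Type*} [TopologicalSpace V]
    {α : V → ProbabilityMeasure S} (hα : Continuous α) {h : V → S →ᵇ ℝ} (hh : Continuous h) :
    Continuous fun t => ∫ y, h t y ∂(α t : Measure S) := by
  refine continuous_iff_continuousAt.2 fun t₀ => ?_
  have h1 : Tendsto (fun t => ∫ y, h t₀ y ∂(α t : Measure S)) (𝓝 t₀)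
      (𝓝 (∫ y, h t₀ y ∂(α t₀ : Measure S))) :=
    ProbabilityMeasure.tendsto_iff_forall_integral_tendsto.1 (hα.tendsto t₀) (h t₀)
  have h2 : Tendsto (fun t => ∫ y, (h t - h t₀) y ∂(α t : Measure S)) (𝓝 t₀) (𝓝 0) := by
    have h3 : Tendsto (fun t => ‖h t - h t₀‖) (𝓝 t₀) (𝓝 0) :=
      tendsto_iff_norm_sub_tendsto_zero.1 (hh.tendsto t₀)
    refine squeeze_zero_norm (fun t => ?_) h3
    simpa using (h t - h t₀).norm_integral_le_norm (μ := (α t : Measure S))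
  have h4 := h2.add h1
  rw [zero_add] at h4
  refine h4.congr fun t => ?_
  rw [← integral_add ((h t - h t₀).integrable _) ((h t₀).integrable _)]
  exact integral_congr_ae (ae_of_all _ fun y => by simp)

theorem integral_withDensity_ofReal {μ : Measure S} [IsFiniteMeasure μ] {h : S →ᵇ ℝ}
    (h0 : ∀ y, 0 ≤ h y) (f : S →ᵇ ℝ) :
    ∫ y, f y ∂μ.withDensity (fun y => ENNReal.ofReal (h y)) = ∫ y, (h * f) y ∂μ := by
  rw [integral_withDensity_eq_integral_toReal_smul h.continuous.measurable.ennreal_ofReal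
    (ae_of_all _ fun y => ENNReal.ofReal_lt_top)]
  exact integral_congr_ae (ae_of_all _ fun y => by simp [ENNReal.toReal_ofReal (h0 y)])

theorem isFiniteMeasure_withDensity_bcf {μ : Measure S} [IsFiniteMeasure μ] (h : S →ᵇ ℝ) :
    IsFiniteMeasure (μ.withDensity fun y => ENNReal.ofReal (h y)) :=
  isFiniteMeasure_withDensity_ofReal (h.integrable μ).2

variable {L V : Type*} [TopologicalSpace V]

/-- The families of densities with values in `[0, 1]`, together with their sum, whose masses are
at most `p` and whose total mass weighted by `w` exceeds `1 - δ`. -/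
def subcouplings (μ : Measure S) (p : L → ℝ) (w : L → S →ᵇ ℝ) (δ : ℝ) :
    Set ((L → S →ᵇ ℝ) × (S →ᵇ ℝ)) :=
  {c | (∀ l y, 0 ≤ c.1 l y) ∧ (∀ y, HasSum (fun l => c.1 l y) (c.2 y)) ∧ (∀ y, c.2 y ≤ 1) ∧
    (∀ l, ∫ y, c.1 l y ∂μ ≤ p l) ∧ ∫ y, c.2 y ∂μ < 1 ∧
    ∃ A : Finset L, 1 - δ < ∑ l ∈ A, ∫ y, (c.1 l * w l) y ∂μ}

theorem integral_bcf_combo (μ : Measure S) [IsFiniteMeasure μ] (s r : ℝ) (f g : S →ᵇ ℝ) :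
    ∫ y, (s • f + r • g) y ∂μ = s * ∫ y, f y ∂μ + r * ∫ y, g y ∂μ := by
  rw [← integral_const_mul, ← integral_const_mul, ← integral_add]
  · exact integral_congr_ae (ae_of_all _ fun y => by simp)
  · exact (f.integrable μ).const_mul s
  · exact (g.integrable μ).const_mul r

theorem convex_subcouplings (μ : Measure S) [IsFiniteMeasure μ] (p : L → ℝ) {w : L → S →ᵇ ℝ}
    (hw : ∀ l y, 0 ≤ w l y) (δ : ℝ) : Convex ℝ (subcouplings μ p w δ) := by
  classical
  have mono : ∀ {c : (L → S →ᵇ ℝ) × (S →ᵇ ℝ)} {A B : Finset L}, (∀ l y, 0 ≤ c.1 l y) → A ⊆ B →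
      ∑ l ∈ A, ∫ y, (c.1 l * w l) y ∂μ ≤ ∑ l ∈ B, ∫ y, (c.1 l * w l) y ∂μ := fun h hAB =>
    Finset.sum_le_sum_of_subset_of_nonneg hAB fun l _ _ =>
      integral_nonneg fun y => mul_nonneg (h l y) (hw l y)
  have combo : ∀ {a b u v s r : ℝ}, a < u → b < v → 0 ≤ s → 0 ≤ r → s + r = 1 →
      s * a + r * b < s * u + r * v := by
    intro a b u v s r hau hbv hs hr hsr
    rcases hs.eq_or_lt with rfl | hs
    · have : r = 1 := by linarith
      subst this
      linarith
    · have := mul_lt_mul_of_pos_left hau hs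
      have := mul_le_mul_of_nonneg_left hbv.le hr
      linarith
  rintro a ⟨a1, a2, a3, a4, a5, A, a6⟩ b ⟨b1, b2, b3, b4, b5, B, b6⟩ s r hs hr hsr
  refine ⟨fun l y => ?_, fun y => ?_, fun y => ?_, fun l => ?_, ?_, A ∪ B, ?_⟩
  · exact add_nonneg (mul_nonneg hs (a1 l y)) (mul_nonneg hr (b1 l y))
  · exact ((a2 y).mul_left s).add ((b2 y).mul_left r)
  · calc (s • a + r • b).2 y = s * a.2 y + r * b.2 y := rfl
      _ ≤ s * 1 + r * 1 := by gcongr; exacts [a3 y, b3 y]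
      _ = 1 := by linarith
  · calc ∫ y, (s • a.1 l + r • b.1 l) y ∂μ = _ := integral_bcf_combo μ s r _ _
      _ ≤ s * p l + r * p l := by gcongr; exacts [a4 l, b4 l]
      _ = p l := by rw [← add_mul, hsr, one_mul]
  · calc ∫ y, (s • a.2 + r • b.2) y ∂μ = _ := integral_bcf_combo μ s r _ _
      _ < s * 1 + r * 1 := combo a5 b5 hs hr hsr
      _ = 1 := by linarith
  · calc 1 - δ = s * (1 - δ) + r * (1 - δ) := by rw [← add_mul, hsr, one_mul]
      _ < s * ∑ l ∈ A ∪ B, ∫ y, (a.1 l * w l) y ∂μ +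
            r * ∑ l ∈ A ∪ B, ∫ y, (b.1 l * w l) y ∂μ :=
        combo (a6.trans_le (mono a1 Finset.subset_union_left))
          (b6.trans_le (mono b1 Finset.subset_union_right)) hs hr hsr
      _ = ∑ l ∈ A ∪ B, ∫ y, (s • (a.1 l * w l) + r • (b.1 l * w l)) y ∂μ := by
        rw [Finset.mul_sum, Finset.mul_sum, ← Finset.sum_add_distrib]
        exact Finset.sum_congr rfl fun l _ => (integral_bcf_combo μ s r _ _).symm
      _ = _ := Finset.sum_congr rfl fun l _ => integral_congr_ae (ae_of_all _ fun y => by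
        simp only [BoundedContinuousFunction.coe_add, BoundedContinuousFunction.coe_smul,
          BoundedContinuousFunction.coe_mul, Pi.add_apply, Pi.mul_apply, Prod.fst_add,
          Prod.smul_fst, Pi.smul_apply, smul_eq_mul]
        ring)

/-- A finite family of densities whose masses are less than `p` and whose total mass weighted by
`w` exceeds `1 - ε`. -/
def HasStrictSubcoupling (μ : Measure S) (p : L → ℝ) (w : L → S →ᵇ ℝ) (ε : ℝ) : Prop :=
  ∃ (A : Finset L) (g : L → S →ᵇ ℝ), (∀ l ∉ A, g l = 0) ∧ (∀ l y, 0 ≤ g l y) ∧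
    (∀ y, ∑ l ∈ A, g l y ≤ 1) ∧ (∀ l ∈ A, ∫ y, g l y ∂μ < p l) ∧
    1 - ε < ∑ l ∈ A, ∫ y, (g l * w l) y ∂μ

/-- The empty family suffices. It gives the a priori loss `2` required by `exists_modulus`. -/
theorem hasStrictSubcoupling_of_one_lt {S L : Type*} [MetricSpace S] [MeasurableSpace S]
    (μ : Measure S) (p : L → ℝ) (w : L → S →ᵇ ℝ) {ε : ℝ}
    (hε : 1 < ε) : HasStrictSubcoupling μ p w ε :=
  ⟨∅, fun _ => 0, by simp, by simp, by simp, by simp, by simpa using hε⟩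

/-- Finitely many strict inequalities between continuous functions of `t` persist near `t₀`, so the
same densities can be kept there. -/
theorem HasStrictSubcoupling.exists_eventually_mem {α : V → ProbabilityMeasure S}
    (hα : Continuous α) {p : V → L → ℝ} (hp : ∀ l, Continuous fun t => p t l)
    (hp0 : ∀ t l, 0 ≤ p t l) (hp1 : ∀ t, HasSum (p t) 1) {w : L → S →ᵇ ℝ} {δ : V → ℝ} {t₀ : V}
    {ε : ℝ} (h : HasStrictSubcoupling (α t₀ : Measure S) (p t₀) w ε)
    (hδ : ∀ᶠ t in 𝓝 t₀, ε ≤ δ t) :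
    ∃ c, ∀ᶠ t in 𝓝 t₀, c ∈ subcouplings (α t : Measure S) (p t) w (δ t) := by
  obtain ⟨A, g, hgA, hg0, hg1, hgp, hgw⟩ := h
  have hint : ∀ f : S →ᵇ ℝ, Continuous fun t => ∫ y, f y ∂(α t : Measure S) := fun f =>
    continuous_integral_of_continuous hα continuous_const
  have hev1 : ∀ᶠ t in 𝓝 t₀, ∀ l ∈ A, ∫ y, g l y ∂(α t : Measure S) < p t l :=
    (Finset.eventually_all A).2 fun l hl =>
      ((hint (g l)).tendsto t₀).eventually_lt ((hp l).tendsto t₀) (hgp l hl)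
  have hev2 : ∀ᶠ t in 𝓝 t₀, 1 - ε < ∑ l ∈ A, ∫ y, (g l * w l) y ∂(α t : Measure S) :=
    ((continuous_finsetSum A fun l _ => hint (g l * w l)).tendsto t₀).eventually
      (lt_mem_nhds hgw)
  refine ⟨(g, ∑ l ∈ A, g l), ?_⟩
  filter_upwards [hev1, hev2, hδ] with t h1 h2 h3
  refine ⟨hg0, fun y => ?_, fun y => ?_, fun l => ?_, ?_, A, by linarith⟩
  · rw [BoundedContinuousFunction.sum_apply]
    exact hasSum_sum_of_ne_finset_zero fun l hl => by simp [hgA l hl]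
  · rw [BoundedContinuousFunction.sum_apply]
    exact hg1 y
  · by_cases hl : l ∈ A
    · exact (h1 l hl).le
    · simpa [hgA l hl] using hp0 t l
  · have : ∫ y, (∑ l ∈ A, g l) y ∂(α t : Measure S) = ∑ l ∈ A, ∫ y, g l y ∂(α t : Measure S) := by
      rw [← integral_finsetSum A fun l _ => (g l).integrable _]
      simp only [BoundedContinuousFunction.sum_apply]
    rw [this]
    rcases A.eq_empty_or_nonempty with rfl | hA
    · simp
    · exact (Finset.sum_lt_sum_of_nonempty hA h1).trans_le
        (sum_le_hasSum A (fun l _ => hp0 t l) (hp1 t))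

/-- A continuous family of probability measures can be split continuously into parts of
prescribed masses `p`, with a total mass weighted by `w` that exceeds `1 - δ`, if this can be done
locally with masses less than `p`. -/
theorem exists_continuous_splitting [Countable L] [NormalSpace V] [ParacompactSpace V]
    {α : V → ProbabilityMeasure S} (hα : Continuous α) {p : V → L → ℝ}
    (hp : ∀ l, Continuous fun t => p t l) (hp0 : ∀ t l, 0 ≤ p t l) (hp1 : ∀ t, HasSum (p t) 1)
    {w : L → S →ᵇ ℝ} (hw : ∀ l y, 0 ≤ w l y) {δ : V → ℝ}
    (H : ∀ t₀, ∃ ε, HasStrictSubcoupling (α t₀ : Measure S) (p t₀) w ε ∧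
      ∀ᶠ t in 𝓝 t₀, ε ≤ δ t) :
    ∃ M : V → L → Measure S, (∀ t l, IsFiniteMeasure (M t l)) ∧
      (∀ l (f : S →ᵇ ℝ), Continuous fun t => ∫ y, f y ∂M t l) ∧
      (∀ t l, M t l Set.univ = ENNReal.ofReal (p t l)) ∧
      (∀ t C, MeasurableSet C → ∑' l, M t l C = (α t : Measure S) C) ∧
      ∀ t, ∃ A : Finset L, 1 - δ t < ∑ l ∈ A, ∫ y, w l y ∂M t l := by
  -- Continuity of all densities does not give continuity of their infinite sum. For this reason the
  -- sum is selected as a component of its own.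
  obtain ⟨c, hc⟩ := exists_continuous_forall_mem_convex_of_local_const
    (t := fun t => subcouplings (α t : Measure S) (p t) w (δ t))
    (fun t => convex_subcouplings _ _ hw _) fun t₀ => by
      obtain ⟨ε, h1, h2⟩ := H t₀
      exact h1.exists_eventually_mem hα hp hp0 hp1 h2
  set e : V → L → ℝ := fun t l => p t l - ∫ y, (c t).1 l y ∂(α t : Measure S) with he
  set R : V → ℝ := fun t => 1 - ∫ y, (c t).2 y ∂(α t : Measure S) with hR
  -- The unused part `1 - (c t).2` of the measure is shared out in proportion to the deficits `e t
  -- l`. These add up to its mass `R t`, so all masses become exact. The strict bound on the total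
  -- mass keeps `R t` positive.
  set h : V → L → S →ᵇ ℝ := fun t l => (c t).1 l + (e t l / R t) • (1 - (c t).2) with hh
  have he0 : ∀ t l, 0 ≤ e t l := fun t l => sub_nonneg.2 ((hc t).2.2.2.1 l)
  have hR0 : ∀ t, 0 < R t := fun t => sub_pos.2 (hc t).2.2.2.2.1
  have hcg : ∀ l, Continuous fun t => (c t).1 l := fun l =>
    (continuous_apply l).comp (continuous_fst.comp c.continuous)
  have hcG : Continuous fun t => (c t).2 := continuous_snd.comp c.continuous
  have hgle : ∀ t l y, (c t).1 l y ≤ h t l y := fun t l y => by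
    have := mul_nonneg (div_nonneg (he0 t l) (hR0 t).le) (sub_nonneg.2 ((hc t).2.2.1 y))
    simpa [hh] using this
  have hh0 : ∀ t l y, 0 ≤ h t l y := fun t l y => ((hc t).1 l y).trans (hgle t l y)
  have hhcont : ∀ l, Continuous fun t => h t l := fun l =>
    (hcg l).add ((((hp l).sub (continuous_integral_of_continuous hα (hcg l))).div
      (continuous_const.sub (continuous_integral_of_continuous hα hcG))
        fun t => (hR0 t).ne').smul (continuous_const.sub hcG))
  have hesum : ∀ t, HasSum (e t) (R t) := fun t =>
    (hp1 t).sub (hasSum_integral_of_hasSum (hc t).1 (hc t).2.1)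
  have hhsum : ∀ t y, HasSum (fun l => h t l y) 1 := by
    intro t y
    have h1 := ((hc t).2.1 y).add (((hesum t).div_const (R t)).mul_right (1 - (c t).2 y))
    rw [div_self (hR0 t).ne', one_mul, add_sub_cancel] at h1
    exact h1
  have hhint : ∀ t l, ∫ y, h t l y ∂(α t : Measure S) = p t l := by
    intro t l
    have h1 := integral_bcf_combo (α t : Measure S) 1 (e t l / R t) ((c t).1 l) (1 - (c t).2)
    have h2 : ∫ y, (1 - (c t).2) y ∂(α t : Measure S) = R t := by
      have := integral_sub (integrable_const (1 : ℝ)) ((c t).2.integrable (α t : Measure S))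
      simpa [hR] using this
    rw [h2, div_mul_cancel₀ _ (hR0 t).ne', one_smul, one_mul] at h1
    rw [hh, h1, he]
    ring
  refine ⟨fun t l => (α t : Measure S).withDensity fun y => ENNReal.ofReal (h t l y),
    fun t l => isFiniteMeasure_withDensity_bcf _, fun l f => ?_, fun t l => ?_, fun t C hC => ?_,
    fun t => ?_⟩
  · simp_rw [integral_withDensity_ofReal (hh0 _ l)]
    exact continuous_integral_of_continuous hα ((hhcont l).mul continuous_const)
  · rw [withDensity_apply _ MeasurableSet.univ, Measure.restrict_univ,
      ← ofReal_integral_eq_lintegral_ofReal ((h t l).integrable _) (ae_of_all _ (hh0 t l)), hhint]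
  · simp_rw [withDensity_apply _ hC]
    rw [← lintegral_tsum fun l => (h t l).continuous.measurable.ennreal_ofReal.aemeasurable]
    have h1 : ∀ y, ∑' l, ENNReal.ofReal (h t l y) = 1 := fun y => by
      rw [← ENNReal.ofReal_tsum_of_nonneg (fun l => hh0 t l y) (hhsum t y).summable,
        (hhsum t y).tsum_eq, ENNReal.ofReal_one]
    simp_rw [h1]
    simp
  · obtain ⟨A, hA⟩ := (hc t).2.2.2.2.2
    refine ⟨A, hA.trans_le (Finset.sum_le_sum fun l _ => ?_)⟩
    rw [integral_withDensity_ofReal (hh0 t l)]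
    exact integral_mono (((c t).1 l * w l).integrable _) ((h t l * w l).integrable _) fun y =>
      mul_le_mul_of_nonneg_right (hgle t l y) (hw l y)

end Selection

/-! ### Cone functions and approximate couplings -/

/-- The function that decreases from `1` at `z` to `0` at distance `1` with slope `1`. -/
noncomputable def cone {S : Type*} [MetricSpace S] (z : S) : S →ᵇ ℝ :=
  BoundedContinuousFunction.ofNormedAddCommGroup (fun y => max 0 (1 - dist y z)) (by fun_prop) 1
    (fun y => by
      rw [Real.norm_eq_abs, abs_of_nonneg (le_max_left _ _)]
      exact max_le zero_le_one (by linarith [dist_nonneg (x := y) (y := z)]))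

section Cone

variable {S : Type*} [MetricSpace S]

theorem cone_nonneg (z y : S) : 0 ≤ cone z y := le_max_left _ _

theorem cone_le_one (z y : S) : cone z y ≤ 1 :=
  max_le zero_le_one (by linarith [dist_nonneg (x := y) (y := z)])

theorem one_sub_dist_le_cone (z y : S) : 1 - dist y z ≤ cone z y := le_max_right _ _

theorem cone_le_one_sub {z y : S} {ε : ℝ} (hε : ε ≤ 1) (h : ε ≤ dist y z) :
    cone z y ≤ 1 - ε := max_le (by linarith) (by linarith)

end Cone

/-- If `Y` is close to a random variable with values `x l` in probability, and if the distribution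
of `Y` is weakly close to `ν`, then `ν` has densities of masses less than those of the values,
concentrated near the values. -/
theorem hasStrictSubcoupling_of_close {S : Type*} [MetricSpace S] [MeasurableSpace S]
    [BorelSpace S] {Ω L : Type*} [MeasurableSpace Ω] {P : Measure Ω} [IsProbabilityMeasure P]
    [Countable L] [MeasurableSpace L] [MeasurableSingletonClass L] {ν : Measure S}
    [IsFiniteMeasure ν] {Y : Ω → S} (hY : Measurable Y) {Lb : Ω → L} (hLb : Measurable Lb)
    {x : L → S} {z : ℕ → S} {ε : ℝ} (hε : 0 < ε) (hε' : ε < 1 / 10)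
    {f : ℕ → S →ᵇ ℝ} (hf0 : ∀ i y, 0 ≤ f i y) (hf1 : ∀ y, HasSum (fun i => f i y) 1)
    (hfd : ∀ i y, f i y ≠ 0 → dist y (z i) < ε) {m : ℕ}
    (hm : 1 - ε < ∑ i ∈ Finset.range m, ∫ ω, f i (Y ω) ∂P)
    (hclose : ∑ i ∈ Finset.range m, |∫ ω, f i (Y ω) ∂P - ∫ y, f i y ∂ν| < ε)
    (hdist : P.real {ω | ε ≤ dist (x (Lb ω)) (Y ω)} ≤ ε) :
    HasStrictSubcoupling ν (fun l => P.real (Lb ⁻¹' {l})) (fun l => cone (x l)) (9 * ε) := by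
  classical
  set p : L → ℝ := fun l => P.real (Lb ⁻¹' {l}) with hp
  set q : ℕ → ℝ := fun i => ∫ ω, f i (Y ω) ∂P with hq
  set q' : ℕ → ℝ := fun i => ∫ y, f i y ∂ν with hq'
  have hpreim : ∀ A : Finset L, ∑ l ∈ A, p l = P.real (Lb ⁻¹' A) := fun A =>
    sum_measureReal_preimage_singleton A fun l _ => hLb (measurableSet_singleton l)
  have hpsum : HasSum p 1 := by
    have h1 : ∑' l, P (Lb ⁻¹' {l}) = 1 := by
      rw [← measure_iUnion (fun l l' hne => Disjoint.preimage _ (by simpa using hne))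
        fun l => hLb (measurableSet_singleton l)]
      rw [← Set.preimage_iUnion, Set.iUnion_of_singleton, Set.preimage_univ, measure_univ]
    have h2 := ENNReal.hasSum_toReal (h1 ▸ ENNReal.one_ne_top)
    rwa [← ENNReal.tsum_toReal_eq fun l => measure_ne_top P _, h1, ENNReal.toReal_one] at h2
  obtain ⟨A₀, hA₀⟩ := (hpsum.eventually (lt_mem_nhds (show 1 - ε < 1 by linarith))).exists
  set A : Finset L := A₀.filter fun l => p l ≠ 0 with hAdef
  have hA : 1 - ε < ∑ l ∈ A, p l := by rwa [hAdef, Finset.sum_filter_ne_zero]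
  have hAp : ∀ l ∈ A, 0 < p l := fun l hl =>
    lt_of_le_of_ne measureReal_nonneg (Finset.mem_filter.1 hl).2.symm
  set E : L → Set Ω := fun l => {ω | Lb ω = l ∧ dist (x l) (Y ω) < ε} with hE
  have hEm : ∀ l, MeasurableSet (E l) := fun l =>
    (hLb (measurableSet_singleton l)).inter
      (((continuous_const.dist continuous_id).measurable.comp hY) measurableSet_Iio)
  have hfY : ∀ i, Integrable (fun ω => f i (Y ω)) P := fun i =>
    Integrable.of_bound ((f i).continuous.measurable.comp hY).aestronglyMeasurable ‖f i‖
      (ae_of_all _ fun ω => (f i).norm_coe_le_norm _)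
  -- A discretised joint law of `Y` and the label, restricted to the event that they are close.
  set π : ℕ → L → ℝ := fun i l => ∫ ω, (E l).indicator (fun ω => f i (Y ω)) ω ∂P with hπ
  have hfE : ∀ i l, Integrable ((E l).indicator fun ω => f i (Y ω)) P := fun i l =>
    (hfY i).indicator (hEm l)
  have hπ0 : ∀ i l, 0 ≤ π i l := fun i l =>
    integral_nonneg fun ω => Set.indicator_nonneg (fun ω _ => hf0 i _) ω
  have hsumE : ∀ (B : Finset L) (φ : Ω → ℝ) ω, ∑ l ∈ B, (E l).indicator φ ω =
      if Lb ω ∈ B ∧ dist (x (Lb ω)) (Y ω) < ε then φ ω else 0 := by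
    intro B φ ω
    have h1 : ∀ l, (E l).indicator φ ω =
        if l = Lb ω then (if dist (x (Lb ω)) (Y ω) < ε then φ ω else 0) else 0 := by
      intro l
      simp only [Set.indicator, hE, Set.mem_ofPred_eq]
      by_cases h : Lb ω = l
      · subst h
        simp
      · simp [h, Ne.symm h]
    simp_rw [h1]
    rw [Finset.sum_ite_eq']
    split_ifs <;> simp_all
  have hπq : ∀ i, ∑ l ∈ A, π i l ≤ q i := by
    intro i
    rw [hπ, ← integral_finsetSum A fun l _ => hfE i l]
    refine integral_mono (integrable_finsetSum A fun l _ => hfE i l) (hfY i) fun ω => ?_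
    dsimp only
    rw [hsumE]
    split_ifs
    exacts [le_rfl, hf0 _ _]
  have hfle : ∀ y, ∑ i ∈ Finset.range m, f i y ≤ 1 := fun y =>
    sum_le_hasSum _ (fun i _ => hf0 i y) (hf1 y)
  have hπp : ∀ l, ∑ i ∈ Finset.range m, π i l ≤ p l := by
    intro l
    have h1 : p l = ∫ ω, (Lb ⁻¹' {l}).indicator 1 ω ∂P :=
      (integral_indicator_one (hLb (measurableSet_singleton l))).symm
    rw [hπ, ← integral_finsetSum _ fun i _ => hfE i l, h1]
    refine integral_mono (integrable_finsetSum _ fun i _ => hfE i l)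
      ((integrable_const (1 : ℝ)).indicator (hLb (measurableSet_singleton l))) fun ω => ?_
    dsimp only
    by_cases hω : ω ∈ E l
    · have : ω ∈ Lb ⁻¹' {l} := hω.1
      simp only [Set.indicator_of_mem hω, Set.indicator_of_mem this]
      exact hfle _
    · simp only [Set.indicator_of_notMem hω, Finset.sum_const_zero]
      exact Set.indicator_nonneg (fun _ _ => zero_le_one) _
  -- One `ε` is lost in each truncation: to finitely many `i`, to labels in `A`, and to the event of
  -- closeness.
  have hπtot : 1 - 3 * ε ≤ ∑ i ∈ Finset.range m, ∑ l ∈ A, π i l := by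
    set bad : Set Ω := {ω | ε ≤ dist (x (Lb ω)) (Y ω)} with hbad
    have hxLb : Measurable fun ω => dist (x (Lb ω)) (Y ω) :=
      measurable_comp_countable (g := fun l ω => dist (x l) (Y ω)) hLb fun l =>
        (continuous_const.dist continuous_id).measurable.comp hY
    have hbadm : MeasurableSet bad := hxLb measurableSet_Ici
    have hcm : MeasurableSet (Lb ⁻¹' (A : Set L))ᶜ :=
      (hLb A.countable_toSet.measurableSet).compl
    have h1 : P.real (Lb ⁻¹' (A : Set L))ᶜ ≤ ε := by
      rw [probReal_compl_eq_one_sub (hLb A.countable_toSet.measurableSet), ← hpreim]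
      linarith
    have hi1 : Integrable (bad.indicator (1 : Ω → ℝ)) P :=
      (integrable_const (1 : ℝ)).indicator hbadm
    have hi2 : Integrable ((Lb ⁻¹' (A : Set L))ᶜ.indicator (1 : Ω → ℝ)) P :=
      (integrable_const (1 : ℝ)).indicator hcm
    have hi12 : Integrable (fun ω => bad.indicator (1 : Ω → ℝ) ω +
        (Lb ⁻¹' (A : Set L))ᶜ.indicator (1 : Ω → ℝ) ω) P := hi1.add hi2
    have hi3 : Integrable (fun ω => ∑ i ∈ Finset.range m, f i (Y ω)) P :=
      integrable_finsetSum _ fun i _ => hfY i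
    have hi4 : Integrable (fun ω => ∑ i ∈ Finset.range m, ∑ l ∈ A,
        (E l).indicator (fun ω => f i (Y ω)) ω) P :=
      integrable_finsetSum _ fun i _ => integrable_finsetSum _ fun l _ => hfE i l
    have h2 : ∫ ω, ∑ i ∈ Finset.range m, f i (Y ω) ∂P ≤
        ∫ ω, (∑ i ∈ Finset.range m, ∑ l ∈ A, (E l).indicator (fun ω => f i (Y ω)) ω) +
          (bad.indicator 1 ω + (Lb ⁻¹' (A : Set L))ᶜ.indicator 1 ω) ∂P := by
      refine integral_mono hi3 (hi4.add hi12) fun ω => ?_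
      dsimp only
      simp_rw [hsumE]
      have hb0 : (0 : ℝ) ≤ bad.indicator 1 ω := Set.indicator_nonneg (fun _ _ => zero_le_one) _
      have hc0 : (0 : ℝ) ≤ (Lb ⁻¹' (A : Set L))ᶜ.indicator 1 ω :=
        Set.indicator_nonneg (fun _ _ => zero_le_one) _
      by_cases hω : Lb ω ∈ A ∧ dist (x (Lb ω)) (Y ω) < ε
      · simp only [if_pos hω]
        linarith
      · simp only [if_neg hω, Finset.sum_const_zero, zero_add]
        refine (hfle _).trans ?_
        rcases not_and_or.1 hω with h | h
        · have : ω ∈ (Lb ⁻¹' (A : Set L))ᶜ := h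
          rw [Set.indicator_of_mem this, Pi.one_apply]
          linarith
        · have : ω ∈ bad := not_lt.1 h
          rw [Set.indicator_of_mem this, Pi.one_apply]
          linarith
    rw [integral_add hi4 hi12, integral_add hi1 hi2, integral_indicator_one hbadm,
      integral_indicator_one hcm, integral_finsetSum _ fun i _ => hfY i,
      integral_finsetSum _ fun i _ => integrable_finsetSum _ fun l _ => hfE i l] at h2
    have h3 : ∀ i, ∫ ω, ∑ l ∈ A, (E l).indicator (fun ω => f i (Y ω)) ω ∂P = ∑ l ∈ A, π i l :=
      fun i => integral_finsetSum A fun l _ => hfE i l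
    simp_rw [h3] at h2
    linarith
  have hq0 : ∀ i, 0 ≤ q i := fun i => integral_nonneg fun ω => hf0 i _
  have hq'0 : ∀ i, 0 ≤ q' i := fun i => integral_nonneg fun y => hf0 i y
  -- Division by `max (q i) (q' i)` serves both bounds: against `q i` the densities add up to at
  -- most `1`, and against `q' i` their masses under `ν` do not exceed those of `π`. The factor `1 -
  -- ε` makes the latter strict.
  set c : ℕ → L → ℝ := fun i l => (1 - ε) * (π i l / max (q i) (q' i)) with hc
  have hmax0 : ∀ i, 0 ≤ max (q i) (q' i) := fun i => (hq0 i).trans (le_max_left _ _)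
  have hc0 : ∀ i l, 0 ≤ c i l := fun i l =>
    mul_nonneg (by linarith) (div_nonneg (hπ0 i l) (hmax0 i))
  have hcsum : ∀ i, ∑ l ∈ A, c i l ≤ 1 := by
    intro i
    rw [hc, ← Finset.mul_sum, ← Finset.sum_div]
    have : (∑ l ∈ A, π i l) / max (q i) (q' i) ≤ 1 :=
      div_le_one_of_le₀ ((hπq i).trans (le_max_left _ _)) (hmax0 i)
    nlinarith [this]
  have hcq : ∀ i l, c i l * q' i ≤ (1 - ε) * π i l := by
    intro i l
    rw [hc, mul_assoc]
    refine mul_le_mul_of_nonneg_left ?_ (by linarith)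
    rw [div_mul_eq_mul_div]
    exact div_le_of_le_mul₀ (hmax0 i) (hπ0 i l)
      (mul_le_mul_of_nonneg_left (le_max_right _ _) (hπ0 i l))
  have hcq' : ∀ i, (1 - ε) * (∑ l ∈ A, π i l - |q i - q' i|) ≤ ∑ l ∈ A, c i l * q' i := by
    intro i
    have h1 : ∑ l ∈ A, c i l * q' i = (1 - ε) * ((∑ l ∈ A, π i l) / max (q i) (q' i) * q' i) := by
      simp only [hc]
      rw [← Finset.sum_mul, ← Finset.mul_sum, ← Finset.sum_div, mul_assoc]
    rw [h1]
    refine mul_le_mul_of_nonneg_left ?_ (by linarith)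
    rcases (hmax0 i).eq_or_lt with h0 | h0
    · rw [← h0, div_zero, zero_mul]
      have := (hπq i).trans (le_max_left (q i) (q' i))
      have := abs_nonneg (q i - q' i)
      linarith
    · set s := ∑ l ∈ A, π i l
      have hs : s / max (q i) (q' i) ≤ 1 :=
        div_le_one_of_le₀ ((hπq i).trans (le_max_left _ _)) (hmax0 i)
      have h2 : s = s / max (q i) (q' i) * max (q i) (q' i) := (div_mul_cancel₀ _ h0.ne').symm
      have h3 : max (q i) (q' i) - q' i ≤ |q i - q' i| := by
        rcases max_cases (q i) (q' i) with h | h <;> rw [h.1]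
        · exact le_abs_self _
        · simp
      have h4 : 0 ≤ max (q i) (q' i) - q' i := sub_nonneg.2 (le_max_right _ _)
      have h5 := mul_le_mul_of_nonneg_right hs h4
      rw [mul_sub, ← h2] at h5
      linarith
  set g : L → S →ᵇ ℝ := fun l => if l ∈ A then ∑ i ∈ Finset.range m, c i l • f i else 0 with hg
  have hgA : ∀ l ∈ A, ∀ y, g l y = ∑ i ∈ Finset.range m, c i l * f i y := fun l hl y => by
    rw [hg]
    simp [hl]
  have hg0 : ∀ l y, 0 ≤ g l y := fun l y => by
    by_cases hl : l ∈ A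
    · rw [hgA l hl]
      exact Finset.sum_nonneg fun i _ => mul_nonneg (hc0 i l) (hf0 i y)
    · simp [hg, hl]
  have hgint : ∀ l ∈ A, ∫ y, g l y ∂ν = ∑ i ∈ Finset.range m, c i l * q' i := fun l hl => by
    simp_rw [hgA l hl]
    rw [integral_finsetSum _ fun i _ => ((f i).integrable ν).const_mul _]
    exact Finset.sum_congr rfl fun i _ => integral_const_mul _ _
  -- If `f i y` and `π i l` are nonzero, then `y` and some `Y ω` are within `ε` of `z i`, and that
  -- `Y ω` is within `ε` of `x l`.
  have hgcone : ∀ l ∈ A, ∀ y, (1 - 3 * ε) * g l y ≤ (g l * cone (x l)) y := by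
    intro l hl y
    rw [BoundedContinuousFunction.coe_mul, Pi.mul_apply, mul_comm]
    by_cases h0 : g l y = 0
    · simp [h0]
    refine mul_le_mul_of_nonneg_left ?_ (hg0 l y)
    rw [hgA l hl] at h0
    obtain ⟨i, -, hi⟩ := Finset.exists_ne_zero_of_sum_ne_zero h0
    have hfi := hfd i y (right_ne_zero_of_mul hi)
    have hπi : π i l ≠ 0 := fun h => left_ne_zero_of_mul hi (by simp [hc, h])
    obtain ⟨ω, hω⟩ : ∃ ω, (E l).indicator (fun ω => f i (Y ω)) ω ≠ 0 := by
      by_contra! hcon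
      exact hπi (by simp only [hπ, hcon, integral_zero])
    have hωE := Set.mem_of_indicator_ne_zero hω
    rw [Set.indicator_of_mem hωE] at hω
    have h1 := hfd i _ hω
    have h2 := hωE.2
    have h3 := dist_triangle4 y (z i) (Y ω) (x l)
    rw [dist_comm (z i), dist_comm (Y ω) (x l)] at h3
    exact (by linarith : 1 - 3 * ε ≤ 1 - dist y (x l)).trans (one_sub_dist_le_cone _ _)
  refine ⟨A, g, fun l hl => by simp [hg, hl], hg0, fun y => ?_, fun l hl => ?_, ?_⟩
  · calc ∑ l ∈ A, g l y = ∑ l ∈ A, ∑ i ∈ Finset.range m, c i l * f i y :=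
          Finset.sum_congr rfl fun l hl => hgA l hl y
      _ = ∑ i ∈ Finset.range m, (∑ l ∈ A, c i l) * f i y := by
        rw [Finset.sum_comm]
        simp_rw [Finset.sum_mul]
      _ ≤ ∑ i ∈ Finset.range m, f i y := Finset.sum_le_sum fun i _ =>
        mul_le_of_le_one_left (hf0 i y) (hcsum i)
      _ ≤ 1 := hfle y
  · calc ∫ y, g l y ∂ν = _ := hgint l hl
      _ ≤ ∑ i ∈ Finset.range m, (1 - ε) * π i l := Finset.sum_le_sum fun i _ => hcq i l
      _ = (1 - ε) * ∑ i ∈ Finset.range m, π i l := by rw [Finset.mul_sum]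
      _ ≤ (1 - ε) * p l := mul_le_mul_of_nonneg_left (hπp l) (by linarith)
      _ < p l := by nlinarith [hAp l hl]
  · have h1 : (1 - ε) * (1 - 4 * ε) ≤ ∑ l ∈ A, ∫ y, g l y ∂ν := by
      calc (1 - ε) * (1 - 4 * ε)
          ≤ (1 - ε) * ((∑ i ∈ Finset.range m, ∑ l ∈ A, π i l) -
              ∑ i ∈ Finset.range m, |q i - q' i|) :=
            mul_le_mul_of_nonneg_left (by linarith) (by linarith)
        _ = ∑ i ∈ Finset.range m, (1 - ε) * (∑ l ∈ A, π i l - |q i - q' i|) := by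
            rw [← Finset.sum_sub_distrib, Finset.mul_sum]
        _ ≤ ∑ i ∈ Finset.range m, ∑ l ∈ A, c i l * q' i := Finset.sum_le_sum fun i _ => hcq' i
        _ = ∑ l ∈ A, ∫ y, g l y ∂ν := by
            rw [Finset.sum_comm]
            exact Finset.sum_congr rfl fun l hl => (hgint l hl).symm
    -- The losses `3 * ε`, `ε` and `4 * ε` add up to `8 * ε`; one more `ε` makes the inequality
    -- strict.
    calc 1 - 9 * ε < (1 - 3 * ε) * ((1 - ε) * (1 - 4 * ε)) := by nlinarith [mul_pos hε hε]
      _ ≤ (1 - 3 * ε) * ∑ l ∈ A, ∫ y, g l y ∂ν :=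
        mul_le_mul_of_nonneg_left h1 (by linarith)
      _ = ∑ l ∈ A, ∫ y, (1 - 3 * ε) * g l y ∂ν := by
        rw [Finset.mul_sum]
        exact Finset.sum_congr rfl fun l _ => (integral_const_mul _ _).symm
      _ ≤ ∑ l ∈ A, ∫ y, (g l * cone (x l)) y ∂ν := Finset.sum_le_sum fun l hl =>
        integral_mono (((g l).integrable ν).const_mul _) ((g l * cone (x l)).integrable ν)
          (hgcone l hl)

/-! ### Uniform estimates near the closed set -/

/-- The best loss valid at all depths up to `2 * r t` is monotone in the depth, so it is controlled
from below near `t₀` by its value at half the depth of `t₀`. The added `r t` pays for an infimum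
that need not be attained. -/
theorem exists_modulus {V : Type*} [TopologicalSpace V] {r : V → ℝ} (hr : Continuous r)
    (hr0 : ∀ t, 0 < r t) {Q : V → ℝ → Prop} (hQ : ∀ t, Q t 2)
    (hu : ∀ ε > 0, ∃ η > 0, ∀ t, r t < η → Q t ε) :
    ∃ δ : V → ℝ, (∀ t₀, ∃ ε, Q t₀ ε ∧ ∀ᶠ t in 𝓝 t₀, ε ≤ δ t) ∧
      ∀ ε > 0, ∃ η > 0, ∀ t, r t < η → δ t < ε := by
  set K : ℝ → Set ℝ := fun s => {ε | 0 < ε ∧ ∀ t, r t ≤ 2 * s → Q t ε} with hK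
  have hne : ∀ s, (K s).Nonempty := fun s => ⟨2, two_pos, fun t _ => hQ t⟩
  have hbdd : ∀ s, BddBelow (K s) := fun s => ⟨0, fun ε h => h.1.le⟩
  have hmono : ∀ s s', s ≤ s' → sInf (K s) ≤ sInf (K s') := fun s s' h =>
    csInf_le_csInf (hbdd s) (hne s') fun ε hε => ⟨hε.1, fun t ht => hε.2 t (by linarith)⟩
  refine ⟨fun t => sInf (K (r t)) + r t, fun t₀ => ?_, fun ε hε => ?_⟩
  · obtain ⟨ε, hε, hlt⟩ := exists_lt_of_csInf_lt (hne (r t₀ / 2))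
      (lt_add_of_pos_right _ (half_pos (hr0 t₀)))
    refine ⟨ε, hε.2 t₀ (by linarith), ?_⟩
    filter_upwards [(hr.tendsto t₀).eventually (lt_mem_nhds (half_lt_self (hr0 t₀)))] with t ht
    linarith [hmono _ _ ht.le]
  · obtain ⟨η, hη, h⟩ := hu (ε / 2) (half_pos hε)
    refine ⟨min (η / 2) (ε / 2), lt_min (half_pos hη) (half_pos hε), fun t ht => ?_⟩
    have h1 := ht.trans_le (min_le_left _ _)
    have h2 := ht.trans_le (min_le_right _ _)
    have h3 : sInf (K (r t)) ≤ ε / 2 :=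
      csInf_le (hbdd _) ⟨half_pos hε, fun t' ht' => h t' (by linarith)⟩
    linarith

section Boundary

variable {T : Type*} [TopologicalSpace T] [CompactSpace T] {B : Set T} {r : T → ℝ}

/-- Compactness: off an open set containing `B`, the function `r` has a positive minimum. -/
theorem exists_pos_of_eventually_comap (hr : Continuous r) (hr0 : ∀ t ∉ B, 0 < r t)
    {Q : (Bᶜ : Set T) → Prop}
    (h : ∀ b ∈ B, ∀ᶠ t in comap (Subtype.val : (Bᶜ : Set T) → T) (𝓝 b), Q t) :
    ∃ η > 0, ∀ t : (Bᶜ : Set T), r t < η → Q t := by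
  have h' : ∀ b ∈ B, ∃ O : Set T, IsOpen O ∧ b ∈ O ∧ ∀ t : (Bᶜ : Set T), (t : T) ∈ O → Q t := by
    intro b hb
    obtain ⟨W, hW, hWQ⟩ := mem_comap.1 (h b hb)
    obtain ⟨O, hOW, hO, hbO⟩ := mem_nhds_iff.1 hW
    exact ⟨O, hO, hbO, fun t ht => hWQ (hOW ht)⟩
  choose! O hO hbO hOQ using h'
  have hopen : IsOpen (⋃ b ∈ B, O b) := isOpen_biUnion hO
  have hQ : ∀ t : (Bᶜ : Set T), (t : T) ∈ ⋃ b ∈ B, O b → Q t := fun t ht => by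
    obtain ⟨b, hb, htb⟩ := Set.mem_iUnion₂.1 ht
    exact hOQ b hb t htb
  rcases (⋃ b ∈ B, O b)ᶜ.eq_empty_or_nonempty with he | hne
  · exact ⟨1, one_pos, fun t _ => hQ t (by rw [Set.compl_empty_iff.1 he]; trivial)⟩
  · obtain ⟨t₀, ht₀, hmin⟩ := hopen.isClosed_compl.isCompact.exists_isMinOn hne hr.continuousOn
    refine ⟨r t₀, hr0 t₀ fun hb => ht₀ (Set.mem_biUnion hb (hbO t₀ hb)), fun t ht => ?_⟩
    by_contra hc
    exact absurd (hmin (fun hmem => hc (hQ t hmem))) (not_le.2 ht)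

end Boundary

theorem tsum_measure_fiber_inter {Ω L : Type*} [MeasurableSpace Ω] {P : Measure Ω} [Countable L]
    [MeasurableSpace L] [MeasurableSingletonClass L] {Lb : Ω → L} (hLb : Measurable Lb)
    {C : Set Ω} (hC : MeasurableSet C) : ∑' l, P (Lb ⁻¹' {l} ∩ C) = P C := by
  rw [← measure_iUnion (fun l l' hne => Disjoint.mono Set.inter_subset_left Set.inter_subset_left
    (Disjoint.preimage _ (by simpa using hne)))
    fun l => (hLb (measurableSet_singleton l)).inter hC]
  rw [← Set.iUnion_inter, ← Set.preimage_iUnion, Set.iUnion_of_singleton, Set.preimage_univ,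
    Set.univ_inter]

/-- Markov's inequality: a cone is at most `1`, and at most `1 - ε` at distance `ε` or more from its
centre, so the bad event costs `ε` times its probability. -/
theorem measureReal_le_dist_lt_of_cone {S : Type*} [MetricSpace S] [MeasurableSpace S]
    [BorelSpace S] {Ω L : Type*} [MeasurableSpace Ω] {P : Measure Ω} [IsProbabilityMeasure P]
    [Countable L] [MeasurableSpace L] [MeasurableSingletonClass L] {Lb : Ω → L}
    (hLb : Measurable Lb) {x : L → S} {Z : Ω → S} (hZ : Measurable Z) {M : L → Measure S}
    [∀ l, IsFiniteMeasure (M l)]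
    (hM : ∀ l C, MeasurableSet C → P (Lb ⁻¹' {l} ∩ Z ⁻¹' C) = M l C) {A : Finset L} {δ : ℝ}
    (hA : 1 - δ < ∑ l ∈ A, ∫ y, cone (x l) y ∂M l) {ε : ℝ} (hε : 0 < ε) (hε1 : ε ≤ 1) :
    ε * P.real {ω | ε ≤ dist (x (Lb ω)) (Z ω)} < δ := by
  set C : L → Set S := fun l => {y | dist y (x l) < ε} with hC
  have hCm : ∀ l, MeasurableSet (C l) := fun l =>
    (continuous_id.dist continuous_const).measurable measurableSet_Iio
  have hreal : ∀ l C, MeasurableSet C → (M l).real C = P.real (Lb ⁻¹' {l} ∩ Z ⁻¹' C) :=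
    fun l C hC => by rw [measureReal_def, ← hM l C hC, measureReal_def]
  have h1 : ∀ l, ∫ y, cone (x l) y ∂M l ≤
      (1 - ε) * P.real (Lb ⁻¹' {l}) + ε * P.real (Lb ⁻¹' {l} ∩ Z ⁻¹' C l) := by
    intro l
    have h2 : ∫ y, cone (x l) y ∂M l ≤ ∫ y, (1 - ε) + ε * (C l).indicator 1 y ∂M l := by
      refine integral_mono ((cone (x l)).integrable _) ((integrable_const _).add
        (((integrable_const (1 : ℝ)).indicator (hCm l)).const_mul ε)) fun y => ?_
      dsimp only
      by_cases hy : y ∈ C l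
      · rw [Set.indicator_of_mem hy, Pi.one_apply]
        linarith [cone_le_one (x l) y]
      · rw [Set.indicator_of_notMem hy]
        linarith [cone_le_one_sub hε1 (not_lt.1 hy : ε ≤ dist y (x l))]
    refine h2.trans_eq ?_
    have hi : Integrable (fun y => ε * (C l).indicator (1 : S → ℝ) y) (M l) :=
      ((integrable_const (1 : ℝ)).indicator (hCm l)).const_mul ε
    rw [integral_add (integrable_const _) hi, integral_const_mul, integral_indicator_one (hCm l), integral_const,
      hreal l _ (hCm l), hreal l _ MeasurableSet.univ, Set.preimage_univ, Set.inter_univ,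
      smul_eq_mul, mul_comm (1 - ε)]
  have h3 : ∑ l ∈ A, P.real (Lb ⁻¹' {l}) ≤ 1 := by
    rw [sum_measureReal_preimage_singleton A fun l _ => hLb (measurableSet_singleton l)]
    exact measureReal_le_one
  set bad : Set Ω := {ω | ε ≤ dist (x (Lb ω)) (Z ω)} with hbad
  have hbadm : MeasurableSet bad :=
    (measurable_comp_countable (g := fun l ω => dist (x l) (Z ω)) hLb fun l =>
      (continuous_const.dist continuous_id).measurable.comp hZ) measurableSet_Ici
  have h4 : ∑ l ∈ A, P.real (Lb ⁻¹' {l} ∩ Z ⁻¹' C l) ≤ 1 - P.real bad := by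
    rw [← probReal_compl_eq_one_sub hbadm, ← measureReal_biUnion_finset]
    · refine measureReal_mono fun ω hω => ?_
      obtain ⟨l, -, hl, hlC⟩ := Set.mem_iUnion₂.1 hω
      rw [Set.mem_preimage, Set.mem_singleton_iff] at hl
      subst hl
      have h : dist (Z ω) (x (Lb ω)) < ε := hlC
      rw [dist_comm] at h
      exact not_le.2 h
    · exact fun l _ l' _ hne => Disjoint.mono Set.inter_subset_left Set.inter_subset_left
        (Disjoint.preimage _ (by simpa using hne))
    · exact fun l _ => (hLb (measurableSet_singleton l)).inter (hZ (hCm l))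
  have h5 : ∑ l ∈ A, ∫ y, cone (x l) y ∂M l ≤
      (1 - ε) * ∑ l ∈ A, P.real (Lb ⁻¹' {l}) + ε * ∑ l ∈ A, P.real (Lb ⁻¹' {l} ∩ Z ⁻¹' C l) := by
    rw [Finset.mul_sum, Finset.mul_sum, ← Finset.sum_add_distrib]
    exact Finset.sum_le_sum fun l _ => h1 l
  have h6 := mul_le_mul_of_nonneg_left h3 (by linarith : 0 ≤ 1 - ε)
  have h7 := mul_le_mul_of_nonneg_left h4 hε.le
  linarith

/-! ### Extension from a closed set -/

/-- Extension of a continuous family of random variables with prescribed distributions from a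
closed set, given discrete random variables on the complement that approximate it. -/
theorem exists_extension_of_labels {S : Type*} [MetricSpace S] [CompleteSpace S]
    [SecondCountableTopology S] [MeasurableSpace S] [BorelSpace S] {x : ℕ → S}
    (hx : DenseRange x) {Ω : Type*} [MeasurableSpace Ω] {P : Measure Ω} [IsProbabilityMeasure P]
    {U : Ω → ℝ} (hU : Measurable U) (hU01 : ∀ ω, U ω ∈ Set.Ioo (0 : ℝ) 1)
    (hU0 : ∀ u, P (U ⁻¹' {u}) = 0) {T : Type*} [MetricSpace T] [CompactSpace T] {B : Set T}
    (hB : IsClosed B) {r : T → ℝ} (hr : Continuous r) (hr0 : ∀ t ∉ B, 0 < r t)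
    (hrB : ∀ t ∈ B, r t = 0) {α : T → ProbabilityMeasure S} (hα : Continuous α)
    {X : B → (Ω →ₘ[P] S)} (hX : Continuous X) (hlaw : ∀ b : B, L0.law (X b) = α b)
    {Λ : ℕ → (Bᶜ : Set T) → ℝ} (hΛ : ∀ j, Continuous (Λ j)) (hΛ0 : ∀ t, Λ 0 t = 0)
    (hΛmono : ∀ t, Monotone fun j => Λ j t)
    (hΛ1 : ∀ t, Tendsto (fun j => Λ j t) atTop (𝓝 1))
    {N : ℕ} (hN : ∀ t, ∃ J : Finset ℕ, J.card ≤ N ∧ ∀ j ∉ J, Λ (j + 1) t = Λ j t)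
    {D : ℕ → Ω → ℕ} (hD : ∀ j, Measurable (D j))
    (hDX : ∀ b : B, ∀ ε > 0, ∀ᶠ t in comap (Subtype.val : (Bᶜ : Set T) → T) (𝓝 (b : T)),
      ∀ j, Λ (j + 1) t ≠ Λ j t → P.real {ω | ε ≤ dist (x (D j ω)) (X b ω)} ≤ ε) :
    ∃ αhat : T → (Ω →ₘ[P] S), Continuous αhat ∧ (∀ b : B, αhat b = X b) ∧
      ∀ t, L0.law (αhat t) = α t := by
  classical
  obtain ⟨L, hL⟩ := exists_label (D := D) hU01 hΛ0 hΛmono hΛ1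
  have hslot : ∀ t l, L t ⁻¹' {l} = slot U Λ D t l := fun t l => by
    ext ω
    exact (hL t ω l).symm
  have hLm : ∀ t, Measurable (L t) := fun t => measurable_to_countable' fun l => by
    rw [hslot]
    exact measurableSet_slot hU hD t l
  have hXm : ∀ b, Measurable (X b : Ω → S) := fun b => (X b).measurable
  -- A union bound over the active indices replaces independence of `U` and the `D j`. The tolerance
  -- `ε / (N + 1)` absorbs their number and is positive even for `N = 0`.
  have hlabel : ∀ b : B, ∀ ε > 0,
      ∀ᶠ t in comap (Subtype.val : (Bᶜ : Set T) → T) (𝓝 (b : T)),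
        P.real {ω | ε ≤ dist (x (L t ω).2) (X b ω)} ≤ ε := by
    intro b ε hε
    have hN1 : (0 : ℝ) < N + 1 := by positivity
    filter_upwards [hDX b (ε / (N + 1)) (by positivity)] with t ht
    obtain ⟨J, hJN, hJ⟩ := hN t
    set J' := J.filter fun j => Λ (j + 1) t ≠ Λ j t with hJ'
    have hsub : {ω | ε ≤ dist (x (L t ω).2) (X b ω)} ⊆
        ⋃ j ∈ J', {ω | ε / (N + 1) ≤ dist (x (D j ω)) (X b ω)} := by
      intro ω hω
      have hmem := (hL t ω (L t ω)).2 rfl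
      have hne : Λ ((L t ω).1 + 1) t ≠ Λ (L t ω).1 t :=
        (hmem.2.1.trans_lt hmem.2.2).ne'
      refine Set.mem_biUnion (x := (L t ω).1) (Finset.mem_coe.2 (Finset.mem_filter.2
        ⟨by_contra fun h => hne (hJ _ h), hne⟩)) ?_
      change ε / (N + 1) ≤ dist (x (D (L t ω).1 ω)) (X b ω)
      rw [hmem.1]
      refine le_trans ?_ hω
      exact div_le_self hε.le (by linarith [(Nat.cast_nonneg N : (0 : ℝ) ≤ N)])
    calc _ ≤ ∑ j ∈ J', P.real {ω | ε / (N + 1) ≤ dist (x (D j ω)) (X b ω)} :=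
          (measureReal_mono hsub (measure_ne_top P _)).trans
            (measureReal_biUnion_finset_le _ _)
      _ ≤ ∑ j ∈ J', ε / (N + 1) :=
          Finset.sum_le_sum fun j hj => ht j (Finset.mem_filter.1 hj).2
      _ = J'.card * (ε / (N + 1)) := by rw [Finset.sum_const, nsmul_eq_mul]
      _ ≤ (N + 1) * (ε / (N + 1)) := by
          gcongr
          have : (J'.card : ℝ) ≤ N := by exact_mod_cast (Finset.card_filter_le _ _).trans hJN
          linarith
      _ = ε := mul_div_cancel₀ _ hN1.ne'
  set αV : (Bᶜ : Set T) → ProbabilityMeasure S := fun t => α t with hαV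
  have hαVc : Continuous αV := hα.comp continuous_subtype_val
  set p : (Bᶜ : Set T) → ℕ × ℕ → ℝ := fun t l => P.real (slot U Λ D t l) with hp
  have hpc : ∀ l, Continuous fun t => p t l :=
    continuous_measureReal_slot hU hU0 hD hΛ hΛmono
  have hp1 : ∀ t, HasSum (p t) 1 := by
    intro t
    have h1 : ∑' l, P (slot U Λ D t l) = 1 := by
      have := tsum_measure_fiber_inter (P := P) (hLm t) MeasurableSet.univ
      simpa only [Set.inter_univ, hslot, measure_univ] using this
    have h2 := ENNReal.hasSum_toReal (h1 ▸ ENNReal.one_ne_top)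
    rwa [← ENNReal.tsum_toReal_eq fun l => measure_ne_top P _, h1, ENNReal.toReal_one] at h2
  have hQ : ∀ ε > 0, ∃ η > 0, ∀ t : (Bᶜ : Set T), r t < η →
      HasStrictSubcoupling (αV t : Measure S) (p t) (fun l => cone (x l.2)) ε := by
    intro ε hε
    obtain ⟨ε', hε', hε'10, hεε'⟩ : ∃ ε' > 0, ε' < 1 / 10 ∧ 9 * ε' ≤ ε :=
      ⟨min (ε / 9) (1 / 20), lt_min (by positivity) (by norm_num),
        (min_le_right _ _).trans_lt (by norm_num), by linarith [min_le_left (ε / 9) (1 / 20)]⟩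
    obtain ⟨f, hf0, hf1, hfd⟩ := exists_unit_partition hx hε'
    refine exists_pos_of_eventually_comap hr hr0 fun b hb => ?_
    have hYint : ∀ i, ∫ ω, f i (X ⟨b, hb⟩ ω) ∂P = ∫ y, f i y ∂(α b : Measure S) := by
      intro i
      rw [← hlaw ⟨b, hb⟩]
      exact (integral_map (hXm _).aemeasurable (f i).continuous.measurable.aestronglyMeasurable).symm
    have hsum : HasSum (fun i => ∫ y, f i y ∂(α b : Measure S)) 1 := by
      have := hasSum_integral_of_hasSum (M := (α b : Measure S)) (G := 1) hf0 hf1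
      simpa using this
    obtain ⟨m, hm⟩ := (hsum.tendsto_sum_nat.eventually
      (lt_mem_nhds (show 1 - ε' < 1 by linarith))).exists
    have hclose : ∀ᶠ t in 𝓝 b, ∑ i ∈ Finset.range m,
        |∫ y, f i y ∂(α b : Measure S) - ∫ y, f i y ∂(α t : Measure S)| < ε' := by
      have hc : Continuous fun t => ∑ i ∈ Finset.range m,
          |∫ y, f i y ∂(α b : Measure S) - ∫ y, f i y ∂(α t : Measure S)| :=
        continuous_finsetSum _ fun i _ => (continuous_const.sub
          (continuous_integral_of_continuous hα continuous_const)).abs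
      refine (hc.tendsto b).eventually (gt_mem_nhds ?_)
      simpa using hε'
    filter_upwards [hlabel ⟨b, hb⟩ ε' hε', tendsto_comap.eventually hclose] with t h1 h2
    have h3 := hasStrictSubcoupling_of_close (P := P) (ν := (αV t : Measure S))
      (hXm ⟨b, hb⟩) (hLm t) (x := fun l : ℕ × ℕ => x l.2) hε' hε'10 hf0 hf1 hfd
      (m := m) (by simpa only [hYint] using hm) (by simpa only [hYint] using h2) h1
    simp only [hslot] at h3
    obtain ⟨A, g, k1, k2, k3, k4, k5⟩ := h3
    exact ⟨A, g, k1, k2, k3, k4, by linarith⟩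
  obtain ⟨δ, hδ1, hδ2⟩ := exists_modulus (r := fun t : (Bᶜ : Set T) => r t)
    (hr.comp continuous_subtype_val) (fun t => hr0 t t.2)
    (fun t => hasStrictSubcoupling_of_one_lt (αV t : Measure S) (p t)
      (fun l => cone (x l.2)) one_lt_two) hQ
  obtain ⟨M, hMfin, hMc, hMmass, hMsum, hMcone⟩ := exists_continuous_splitting hαVc hpc
    (fun t l => measureReal_nonneg) hp1 (fun l => cone_nonneg (x l.2)) hδ1
  obtain ⟨Z, hZc, hZM⟩ := exists_continuous_of_slot_measures hx hU hU01 hU0 hΛ hΛ0 hΛmono hΛ1 hD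
    M hMc fun t l => by rw [hMmass, hp, ofReal_measureReal]
  have hZm : ∀ t, Measurable (Z t : Ω → S) := fun t => (Z t).measurable
  have hZlaw : ∀ t, L0.law (Z t) = αV t := by
    intro t
    refine Subtype.ext (Measure.ext fun C hC => ?_)
    change P.map (Z t) C = (αV t : Measure S) C
    rw [Measure.map_apply (hZm t) hC, ← hMsum t C hC,
      ← tsum_measure_fiber_inter (hLm t) (hZm t hC)]
    exact tsum_congr fun l => by rw [hslot, hZM t l C hC]
  have hZX : ∀ b : B, Tendsto Z (comap (Subtype.val : (Bᶜ : Set T) → T) (𝓝 (b : T)))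
      (𝓝 (X b)) := by
    intro b
    rw [Metric.tendsto_nhds]
    intro ε₀ hε₀
    obtain ⟨ε, hε, hε1, hεε₀⟩ : ∃ ε > 0, ε ≤ 1 ∧ 2 * ε < ε₀ :=
      ⟨min (ε₀ / 3) 1, lt_min (by positivity) one_pos, min_le_right _ _,
        by linarith [min_le_left (ε₀ / 3) 1]⟩
    -- A loss below `ε * ε` bounds the probability of a displacement of at least `ε` by `ε`, after
    -- division by `ε` in Markov's inequality.
    obtain ⟨η, hη, hηδ⟩ := hδ2 (ε * ε) (mul_pos hε hε)
    have hrη : ∀ᶠ t in 𝓝 (b : T), r t < η :=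
      (hr.tendsto b).eventually (gt_mem_nhds (by rwa [hrB b b.2]))
    filter_upwards [hlabel b ε hε, tendsto_comap.eventually hrη] with t h1 h2
    obtain ⟨A, hA⟩ := hMcone t
    have h3 := measureReal_le_dist_lt_of_cone (hLm t) (hZm t) (x := fun l : ℕ × ℕ => x l.2)
      (fun l C hC => by rw [hslot]; exact hZM t l C hC) hA hε hε1
    have h4 : P.real {ω | ε ≤ dist (x (L t ω).2) (Z t ω)} ≤ ε :=
      (lt_of_mul_lt_mul_left (h3.trans (hηδ t h2)) hε.le).le
    have hsub : {ω | 2 * ε ≤ dist (Z t ω) (X b ω)} ⊆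
        {ω | ε ≤ dist (x (L t ω).2) (Z t ω)} ∪ {ω | ε ≤ dist (x (L t ω).2) (X b ω)} := by
      intro ω hω
      by_contra hc
      simp only [Set.mem_union, Set.mem_ofPred_eq, not_or, not_le] at hc hω
      have := dist_triangle_left (Z t ω) (X b ω) (x (L t ω).2)
      linarith [hc.1, hc.2]
    refine lt_of_le_of_lt (L0.rho_le (ε := 2 * ε) ⟨by positivity, ?_⟩) hεε₀
    calc _ ≤ _ := measureReal_mono hsub
      _ ≤ _ := measureReal_union_le _ _
      _ ≤ 2 * ε := by linarith
  refine ⟨fun t => if h : t ∈ B then X ⟨t, h⟩ else Z ⟨t, h⟩, ?_, fun b => ?_, fun t => ?_⟩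
  · set αhat : T → (Ω →ₘ[P] S) := fun t => if h : t ∈ B then X ⟨t, h⟩ else Z ⟨t, h⟩ with hαhat
    have hrestB : ∀ b : B, αhat b = X b := fun b => dif_pos b.2
    have hrestV : ∀ t : (Bᶜ : Set T), αhat t = Z t := fun t => dif_neg t.2
    refine continuous_iff_continuousAt.2 fun t₀ => ?_
    by_cases h : t₀ ∈ B
    · rw [ContinuousAt, ← nhdsWithin_univ, ← Set.union_compl_self B, nhdsWithin_union,
        tendsto_sup]
      constructor
      · rw [tendsto_nhdsWithin_iff_subtype h, show B.domRestrict αhat = X from funext hrestB,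
          show αhat t₀ = X ⟨t₀, h⟩ from hrestB ⟨t₀, h⟩]
        exact hX.tendsto _
      · rw [nhdsWithin, ← map_comap_setCoe_val, tendsto_map'_iff,
          show αhat t₀ = X ⟨t₀, h⟩ from hrestB ⟨t₀, h⟩, show αhat ∘ Subtype.val = Z from
            funext hrestV]
        exact hZX ⟨t₀, h⟩
    · have : ContinuousOn αhat Bᶜ := by
        rw [continuousOn_iff_continuous_domRestrict, show (Bᶜ).domRestrict αhat = Z from funext hrestV]
        exact hZc
      exact this.continuousAt (hB.isOpen_compl.mem_nhds h)
  · exact dif_pos b.2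
  · dsimp only
    split_ifs with h
    · exact hlaw ⟨t, h⟩
    · exact hZlaw ⟨t, h⟩

/-- Extension from a closed set whose complement has a Whitney partition of unity of bounded
multiplicity. -/
theorem exists_extension_of_whitney {S : Type*} [MetricSpace S] [CompleteSpace S]
    [SecondCountableTopology S] [MeasurableSpace S] [BorelSpace S] {Ω : Type*}
    [MeasurableSpace Ω] {P : Measure Ω} [IsProbabilityMeasure P] (hP : Nonatomic P)
    {T : Type*} [MetricSpace T] [CompactSpace T] {B : Set T}
    {r : T → ℝ} (hr : Continuous r) (hr0 : ∀ t ∉ B, 0 < r t)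
    (hrB : ∀ t ∈ B, r t = 0) {α : T → ProbabilityMeasure S} (hα : Continuous α)
    {X : B → (Ω →ₘ[P] S)} (hX : Continuous X) (hlaw : ∀ b : B, L0.law (X b) = α b)
    {φ : ℕ → T → ℝ} (hφ : ∀ j, Continuous (φ j)) (hφ0 : ∀ j t, 0 ≤ φ j t)
    (hφ1 : ∀ t ∉ B, HasSum (fun j => φ j t) 1)
    {N : ℕ} (hN : ∀ t, ∃ J : Finset ℕ, J.card ≤ N ∧ ∀ j ∉ J, φ j t = 0)
    {c : ℝ} (hφr : ∀ j t t', φ j t ≠ 0 → φ j t' ≠ 0 → dist t t' ≤ c * r t ∧ r t' ≤ c * r t) :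
    ∃ αhat : T → (Ω →ₘ[P] S), Continuous αhat ∧ (∀ b : B, αhat b = X b) ∧
      ∀ t, L0.law (αhat t) = α t := by
  classical
  rcases isEmpty_or_nonempty T with hT | ⟨⟨t₀⟩⟩
  · exact ⟨fun t => isEmptyElim t, continuous_of_const fun t => isEmptyElim t,
      fun b => isEmptyElim (b : T), fun t => isEmptyElim t⟩
  have hS : Nonempty S := nonempty_of_isProbabilityMeasure (α t₀ : Measure S)
  obtain ⟨x, hx⟩ := TopologicalSpace.exists_dense_seq S
  obtain ⟨U, hU, hU01, hU0⟩ := hP.exists_diffuse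
  have hBr : B = r ⁻¹' {0} := by
    ext t
    refine ⟨fun h => hrB t h, fun h => ?_⟩
    by_contra hc
    exact (hr0 t hc).ne' h
  have hB : IsClosed B := hBr ▸ isClosed_singleton.preimage hr
  -- `D` is the first index of a dense point within `r τ` of `X b`, where `b` is a point of `B`
  -- nearest to `τ`. If `B` is empty or `φ j` vanishes off `B`, any label will do.
  have hex : ∀ j, ∃ D : Ω → ℕ, Measurable D ∧
      ∀ t ∉ B, φ j t ≠ 0 → B.Nonempty → ∃ (τ : T) (b : B), τ ∉ B ∧ φ j τ ≠ 0 ∧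
        (∀ b' : B, dist τ b ≤ dist τ b') ∧ ∀ ω, dist (x (D ω)) (X b ω) < r τ := by
    intro j
    by_cases h : (∃ τ ∉ B, φ j τ ≠ 0) ∧ B.Nonempty
    · obtain ⟨⟨τ, hτB, hτ⟩, hne⟩ := h
      obtain ⟨b, hb, hbmin⟩ := hB.isCompact.exists_isMinOn hne
        (continuous_const.dist continuous_id : Continuous fun b => dist τ b).continuousOn
      have hdec : ∀ ω, ∃ i, dist (x i) (X ⟨b, hb⟩ ω) < r τ := fun ω => by
        obtain ⟨i, hi⟩ := hx.exists_dist_lt (X ⟨b, hb⟩ ω) (hr0 τ hτB)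
        exact ⟨i, by rwa [dist_comm]⟩
      refine ⟨fun ω => Nat.find (hdec ω), measurable_find hdec fun i => ?_, fun t _ _ _ =>
        ⟨τ, ⟨b, hb⟩, hτB, hτ, fun b' => hbmin b'.2, fun ω => Nat.find_spec (hdec ω)⟩⟩
      exact ((continuous_const.dist continuous_id).measurable.comp (X ⟨b, hb⟩).measurable)
        measurableSet_Iio
    · exact ⟨fun _ => 0, measurable_const, fun t ht h1 h2 => absurd ⟨⟨t, ht, h1⟩, h2⟩ h⟩
  choose D hD hDτ using hex
  have hsucc : ∀ (t : T) j, ∑ i ∈ Finset.range (j + 1), φ i t - ∑ i ∈ Finset.range j, φ i t =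
      φ j t := fun t j => by rw [Finset.sum_range_succ, add_sub_cancel_left]
  refine exists_extension_of_labels hx hU hU01 hU0 hB hr hr0 hrB hα hX hlaw
    (Λ := fun j t => ∑ i ∈ Finset.range j, φ i t) (N := N) (D := D)
    (fun j => continuous_finsetSum _ fun i _ => (hφ i).comp continuous_subtype_val)
    (fun t => by simp)
    (fun t => monotone_nat_of_le_succ fun j => by linarith [hsucc t j, hφ0 j t])
    (fun t => (hφ1 t t.2).tendsto_sum_nat) (fun t => ?_) hD fun b ε hε => ?_
  · obtain ⟨J, hJN, hJ⟩ := hN t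
    exact ⟨J, hJN, fun j hj => by linarith [hsucc t j, hJ j hj]⟩
  · obtain ⟨η, hη, hηX⟩ := Metric.continuous_iff.1 hX b (ε / 2) (half_pos hε)
    have hev : ∀ᶠ t in 𝓝 (b : T), 2 * (c * r t + dist t b) < η ∧ c * r t < ε / 2 := by
      have h1 : Continuous fun t => 2 * (c * r t + dist t b) := by fun_prop
      have h2 : Continuous fun t => c * r t := by fun_prop
      exact ((h1.tendsto _).eventually (gt_mem_nhds (by simpa [hrB b b.2] using hη))).and
        ((h2.tendsto _).eventually (gt_mem_nhds (by simpa [hrB b b.2] using hε)))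
    filter_upwards [tendsto_comap.eventually hev] with t ht j hj
    have hφj : φ j t ≠ 0 := by
      rw [← hsucc t j]
      exact sub_ne_zero.2 hj
    obtain ⟨τ, b', hτB, hτ, hb', hDb⟩ := hDτ j t t.2 hφj ⟨b, b.2⟩
    obtain ⟨h1, h2⟩ := hφr j t τ hφj hτ
    -- As `b'` is nearest to `τ`, its distance from `b` is at most twice that of `τ` from `b`, and
    -- `τ` is within `c * r t` of `t`.
    have hb'b : dist b' b < η := by
      have h3 := hb' b
      have h4 := dist_triangle_left (b' : T) b τ
      have h5 := dist_triangle_left τ (b : T) t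
      calc dist b' b = dist (b' : T) b := rfl
        _ ≤ 2 * (c * r t + dist (t : T) b) := by linarith
        _ < η := ht.1
    have h6 := L0.measureReal_le_of_rho_lt (hηX b' hb'b)
    refine (measureReal_mono fun ω hω => ?_).trans (h6.trans (half_le_self hε.le))
    change ε / 2 ≤ dist (X b' ω) (X b ω)
    have h7 : ε ≤ dist (x (D j ω)) (X b ω) := hω
    have h8 := dist_triangle (x (D j ω)) (X b' ω) (X b ω)
    linarith [hDb ω, ht.2]

/-! ### A Whitney partition of unity on the cube -/

section CubePartition

/-- The truncation of a real number to the unit interval. -/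
noncomputable def clamp (s : ℝ) : ℝ := max 0 (min 1 s)

theorem continuous_clamp : Continuous clamp := by
  unfold clamp
  fun_prop

theorem clamp_mono : Monotone clamp := fun _ _ h => max_le_max le_rfl (min_le_min le_rfl h)

theorem clamp_of_nonpos {s : ℝ} (h : s ≤ 0) : clamp s = 0 :=
  max_eq_left ((min_le_right _ _).trans h)

theorem clamp_of_one_le {s : ℝ} (h : 1 ≤ s) : clamp s = 1 := by
  rw [clamp, min_eq_left h, max_eq_right zero_le_one]

/-- The hat function with peak at `v`. -/
noncomputable def hat (v : ℕ) (y : ℝ) : ℝ := clamp (y - v + 1) - clamp (y - v)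

theorem continuous_hat (v : ℕ) : Continuous (hat v) :=
  (continuous_clamp.comp (by fun_prop)).sub (continuous_clamp.comp (by fun_prop))

theorem hat_nonneg (v : ℕ) (y : ℝ) : 0 ≤ hat v y := sub_nonneg.2 (clamp_mono (by linarith))

theorem abs_sub_lt_one_of_hat_ne_zero {v : ℕ} {y : ℝ} (h : hat v y ≠ 0) : |y - v| < 1 := by
  by_contra hc
  rcases le_abs.1 (not_lt.1 hc) with h1 | h1
  · exact h (by rw [hat, clamp_of_one_le h1, clamp_of_one_le (by linarith), sub_self])
  · exact h (by
      rw [hat, clamp_of_nonpos (s := y - v) (by linarith), clamp_of_nonpos (by linarith),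
        sub_self])

theorem sum_hat {y : ℝ} (hy : 0 ≤ y) {m : ℕ} (hm : y + 1 ≤ m) :
    ∑ v ∈ Finset.range m, hat v y = 1 := by
  have h : ∀ m : ℕ, ∑ v ∈ Finset.range m, hat v y = clamp (y + 1) - clamp (y + 1 - m) := by
    intro m
    induction m with
    | zero => simp
    | succ m ih =>
      rw [Finset.sum_range_succ, ih, hat]
      push_cast
      rw [show y + 1 - (m + 1 : ℝ) = y - m by ring, show y + 1 - (m : ℝ) = y - m + 1 by ring]
      ring
  rw [h, clamp_of_one_le (by linarith), clamp_of_nonpos (by linarith), sub_zero]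

theorem mem_of_hat_ne_zero {v : ℕ} {y : ℝ} (hy : 0 ≤ y) (h : hat v y ≠ 0) :
    v ∈ ({⌊y⌋₊, ⌊y⌋₊ + 1} : Finset ℕ) := by
  have h1 := abs_lt.1 (abs_sub_lt_one_of_hat_ne_zero h)
  have h2 := Nat.floor_le hy
  have h3 := Nat.lt_floor_add_one y
  have h4 : (⌊y⌋₊ : ℝ) < v + 1 := by linarith
  have h5 : (v : ℝ) < ⌊y⌋₊ + 2 := by linarith
  have h4' : ⌊y⌋₊ < v + 1 := by exact_mod_cast h4
  have h5' : v < ⌊y⌋₊ + 2 := by exact_mod_cast h5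
  rw [Finset.mem_insert, Finset.mem_singleton]
  omega

/-- The dyadic partition of unity on `(0, 1]`. -/
noncomputable def dyadicHat (k : ℕ) (s : ℝ) : ℝ :=
  clamp (2 ^ (k + 1) * s - 1) - clamp (2 ^ k * s - 1)

theorem continuous_dyadicHat (k : ℕ) : Continuous (dyadicHat k) :=
  (continuous_clamp.comp (by fun_prop)).sub (continuous_clamp.comp (by fun_prop))

theorem dyadicHat_nonneg (k : ℕ) {s : ℝ} (hs : 0 ≤ s) : 0 ≤ dyadicHat k s := by
  refine sub_nonneg.2 (clamp_mono ?_)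
  have : 0 ≤ 2 ^ k * s := by positivity
  rw [pow_succ]
  linarith

theorem dyadicHat_eq_zero {k : ℕ} {s : ℝ} (h : 2 ≤ 2 ^ k * s) :
    dyadicHat k s = 0 := by
  rw [dyadicHat, clamp_of_one_le (s := 2 ^ k * s - 1) (by linarith), clamp_of_one_le, sub_self]
  rw [pow_succ]
  linarith

theorem lt_of_dyadicHat_ne_zero {k : ℕ} {s : ℝ} (hs : 0 ≤ s) (h : dyadicHat k s ≠ 0) :
    1 < 2 * (2 ^ k * s) ∧ 2 ^ k * s < 2 := by
  have h0 : 0 ≤ 2 ^ k * s := by positivity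
  constructor
  · by_contra hc
    refine h ?_
    rw [dyadicHat, clamp_of_nonpos (s := 2 ^ k * s - 1) (by linarith), clamp_of_nonpos, sub_zero]
    rw [pow_succ]
    linarith
  · by_contra hc
    exact h (dyadicHat_eq_zero (not_lt.1 hc))

theorem sum_dyadicHat {s : ℝ} (hs : s ≤ 1) {m : ℕ} (hm : 2 ≤ 2 ^ m * s) :
    ∑ k ∈ Finset.range m, dyadicHat k s = 1 := by
  have h : ∑ k ∈ Finset.range m, dyadicHat k s =
      clamp (2 ^ m * s - 1) - clamp (2 ^ 0 * s - 1) :=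
    Finset.sum_range_sub (fun k => clamp (2 ^ k * s - 1)) m
  rw [h, clamp_of_one_le (by linarith), clamp_of_nonpos (by linarith), sub_zero]

/-- A nonzero value forces `1 / 2 < 2 ^ k * s < 2`, a window of ratio `4`, which leaves room for at
most two consecutive `k`. -/
theorem exists_forall_dyadicHat_eq_zero {s : ℝ} (hs : 0 ≤ s) :
    ∃ K : Finset ℕ, K.card ≤ 2 ∧ ∀ k ∉ K, dyadicHat k s = 0 := by
  classical
  by_cases h : ∃ k, dyadicHat k s ≠ 0
  · refine ⟨{Nat.find h, Nat.find h + 1}, Finset.card_le_two, fun k hk => ?_⟩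
    by_contra hne
    rw [Finset.mem_insert, Finset.mem_singleton, not_or] at hk
    have h1 := Nat.find_min' h hne
    obtain ⟨d, rfl⟩ := Nat.exists_eq_add_of_le (show Nat.find h + 2 ≤ k by omega)
    have h2 := (lt_of_dyadicHat_ne_zero hs (Nat.find_spec h)).1
    have h3 := (lt_of_dyadicHat_ne_zero hs hne).2
    have h4 : (2 : ℝ) ^ (Nat.find h + 2 + d) * s = 4 * 2 ^ d * (2 ^ Nat.find h * s) := by ring
    have h5 : (1 : ℝ) ≤ 2 ^ d := one_le_pow₀ one_le_two
    rw [h4] at h3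
    nlinarith
  · push Not at h
    exact ⟨∅, by simp, fun k _ => h k⟩

variable {n : ℕ}

/-- A function on the cube that vanishes exactly on the boundary. -/
noncomputable def cubeDepth (t : Fin n → unitInterval) : ℝ := ∏ i, ((t i : ℝ) * (1 - t i))

theorem continuous_cubeDepth : Continuous (cubeDepth (n := n)) := by
  unfold cubeDepth
  fun_prop

theorem cubeDepth_nonneg (t : Fin n → unitInterval) : 0 ≤ cubeDepth t :=
  Finset.prod_nonneg fun i _ => mul_nonneg (t i).2.1 (sub_nonneg.2 (t i).2.2)

theorem cubeDepth_le_one (t : Fin n → unitInterval) : cubeDepth t ≤ 1 :=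
  Finset.prod_le_one (fun i _ => mul_nonneg (t i).2.1 (sub_nonneg.2 (t i).2.2)) fun i _ =>
    mul_le_one₀ (t i).2.2 (sub_nonneg.2 (t i).2.2) (by linarith [(t i).2.1])

theorem cubeDepth_eq_zero_iff (t : Fin n → unitInterval) :
    cubeDepth t = 0 ↔ t ∈ Cube.boundary (Fin n) := by
  rw [cubeDepth, Finset.prod_eq_zero_iff]
  simp only [Finset.mem_univ, true_and, mul_eq_zero, sub_eq_zero]
  refine exists_congr fun i => or_congr ?_ ?_
  · exact ⟨fun h => Subtype.ext h, fun h => by rw [h]; rfl⟩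
  · exact ⟨fun h => Subtype.ext h.symm, fun h => by rw [h]; rfl⟩

/-- The products of hat functions at scale `2⁻ᵏ`, used at depth comparable to `2⁻ᵏ`. -/
noncomputable def cubeBump (q : ℕ × (Fin n → ℕ)) (t : Fin n → unitInterval) : ℝ :=
  dyadicHat q.1 (cubeDepth t) * ∏ i, hat (q.2 i) (2 ^ q.1 * (t i : ℝ))

theorem continuous_cubeBump (q : ℕ × (Fin n → ℕ)) : Continuous (cubeBump q) :=
  ((continuous_dyadicHat _).comp continuous_cubeDepth).mul
    (continuous_finsetProd _ fun i _ => (continuous_hat _).comp (by fun_prop))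

theorem cubeBump_nonneg (q : ℕ × (Fin n → ℕ)) (t : Fin n → unitInterval) : 0 ≤ cubeBump q t :=
  mul_nonneg (dyadicHat_nonneg _ (cubeDepth_nonneg t)) (Finset.prod_nonneg fun _ _ => hat_nonneg _ _)

theorem hat_ne_zero_of_cubeBump_ne_zero {q : ℕ × (Fin n → ℕ)} {t : Fin n → unitInterval}
    (h : cubeBump q t ≠ 0) (i : Fin n) : hat (q.2 i) (2 ^ q.1 * (t i : ℝ)) ≠ 0 :=
  Finset.prod_ne_zero_iff.1 (right_ne_zero_of_mul h) i (Finset.mem_univ i)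

theorem scaled_nonneg (k : ℕ) (y : unitInterval) : 0 ≤ 2 ^ k * (y : ℝ) :=
  mul_nonneg (by positivity) y.2.1

theorem hasSum_cubeBump {t : Fin n → unitInterval} (ht : t ∉ Cube.boundary (Fin n)) :
    HasSum (fun q => cubeBump q t) 1 := by
  have hd : 0 < cubeDepth t :=
    lt_of_le_of_ne (cubeDepth_nonneg t) fun h => ht ((cubeDepth_eq_zero_iff t).1 h.symm)
  obtain ⟨m, hm⟩ := pow_unbounded_of_one_lt (2 / cubeDepth t) (one_lt_two (α := ℝ))
  have hm' : 2 ≤ 2 ^ m * cubeDepth t := ((div_lt_iff₀ hd).1 hm).le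
  set M : ℕ := 2 ^ m + 1 with hM
  have hle : ∀ k < m, ∀ i, 2 ^ k * (t i : ℝ) + 1 ≤ (M : ℝ) := by
    intro k hk i
    have h1 : (2 : ℝ) ^ k ≤ 2 ^ m := pow_le_pow_right₀ one_le_two hk.le
    have h2 : 2 ^ k * (t i : ℝ) ≤ 2 ^ k := mul_le_of_le_one_right (by positivity) (t i).2.2
    rw [hM]
    push_cast
    linarith
  have hsum : ∑ q ∈ Finset.range m ×ˢ Fintype.piFinset fun _ : Fin n => Finset.range M,
      cubeBump q t = 1 := by
    rw [Finset.sum_product]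
    rw [← sum_dyadicHat (cubeDepth_le_one t) hm']
    refine Finset.sum_congr rfl fun k hk => ?_
    simp only [cubeBump]
    rw [← Finset.mul_sum, Finset.sum_prod_piFinset (Finset.range M)
      fun i v => hat v (2 ^ k * (t i : ℝ))]
    rw [Finset.prod_eq_one fun i _ =>
      sum_hat (scaled_nonneg k (t i)) (hle k (Finset.mem_range.1 hk) i), mul_one]
  rw [← hsum]
  refine hasSum_sum_of_ne_finset_zero fun q hq => ?_
  by_contra hne
  refine hq (Finset.mem_product.2 ⟨?_, Fintype.mem_piFinset.2 fun i => ?_⟩)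
  · rw [Finset.mem_range]
    by_contra hc
    refine left_ne_zero_of_mul hne (dyadicHat_eq_zero (hm'.trans ?_))
    exact mul_le_mul_of_nonneg_right (pow_le_pow_right₀ one_le_two (not_lt.1 hc)) hd.le
  · have hk : q.1 < m := by
      by_contra hc
      refine left_ne_zero_of_mul hne (dyadicHat_eq_zero (hm'.trans ?_))
      exact mul_le_mul_of_nonneg_right (pow_le_pow_right₀ one_le_two (not_lt.1 hc)) hd.le
    have h1 := abs_lt.1 (abs_sub_lt_one_of_hat_ne_zero (hat_ne_zero_of_cubeBump_ne_zero hne i))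
    have h2 := hle q.1 hk i
    have h3 : (q.2 i : ℝ) < M := by linarith
    exact Finset.mem_range.2 (by exact_mod_cast h3)

/-- At most two scales are active and, at each scale, two grid points per coordinate. -/
theorem exists_forall_cubeBump_eq_zero (t : Fin n → unitInterval) :
    ∃ J : Finset (ℕ × (Fin n → ℕ)), J.card ≤ 2 * 2 ^ n ∧ ∀ q ∉ J, cubeBump q t = 0 := by
  classical
  obtain ⟨K, hK, hK0⟩ := exists_forall_dyadicHat_eq_zero (cubeDepth_nonneg t)
  set W : ℕ → Finset (Fin n → ℕ) := fun k => Fintype.piFinset fun i =>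
    {⌊2 ^ k * (t i : ℝ)⌋₊, ⌊2 ^ k * (t i : ℝ)⌋₊ + 1} with hW
  have hWcard : ∀ k, (W k).card ≤ 2 ^ n := fun k => by
    rw [hW, Fintype.card_piFinset]
    refine (Finset.prod_le_prod' fun i _ => Finset.card_le_two).trans ?_
    simp
  refine ⟨K.biUnion fun k => (W k).image (Prod.mk k), ?_, fun q hq => ?_⟩
  · exact (Finset.card_biUnion_le_card_mul _ _ _ fun k _ =>
      Finset.card_image_le.trans (hWcard k)).trans (Nat.mul_le_mul_right _ hK)
  · by_contra hne
    refine hq (Finset.mem_biUnion.2 ⟨q.1, by_contra fun h => left_ne_zero_of_mul hne (hK0 _ h),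
      Finset.mem_image.2 ⟨q.2, Fintype.mem_piFinset.2 fun i => ?_, rfl⟩⟩)
    exact mem_of_hat_ne_zero (scaled_nonneg _ _) (hat_ne_zero_of_cubeBump_ne_zero hne i)

/-- Both points are within `2⁻ᵏ` of one grid point, and both depths lie between `2⁻ᵏ / 2` and `2 *
2⁻ᵏ`, where `k = q.1`; hence the factor `4` in both bounds. -/
theorem dist_le_of_cubeBump_ne_zero {q : ℕ × (Fin n → ℕ)} {t t' : Fin n → unitInterval}
    (h : cubeBump q t ≠ 0) (h' : cubeBump q t' ≠ 0) :
    dist t t' ≤ 4 * cubeDepth t ∧ cubeDepth t' ≤ 4 * cubeDepth t := by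
  have hp : (0 : ℝ) < 2 ^ q.1 := by positivity
  have h1 := (lt_of_dyadicHat_ne_zero (cubeDepth_nonneg t) (left_ne_zero_of_mul h)).1
  have h2 := (lt_of_dyadicHat_ne_zero (cubeDepth_nonneg t') (left_ne_zero_of_mul h')).2
  constructor
  · rw [dist_pi_le_iff (mul_nonneg (by norm_num) (cubeDepth_nonneg t))]
    intro i
    have h3 := abs_lt.1 (abs_sub_lt_one_of_hat_ne_zero (hat_ne_zero_of_cubeBump_ne_zero h i))
    have h4 := abs_lt.1 (abs_sub_lt_one_of_hat_ne_zero (hat_ne_zero_of_cubeBump_ne_zero h' i))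
    rw [Subtype.dist_eq, Real.dist_eq, abs_le]
    constructor
    · refine le_of_mul_le_mul_left ?_ hp
      linarith
    · refine le_of_mul_le_mul_left ?_ hp
      linarith
  · refine le_of_mul_le_mul_left ?_ hp
    linarith

end CubePartition

/-! ### The extension theorem for the cube -/

theorem theorem3 (n : ℕ)
    {S : Type*} [MetricSpace S] [CompleteSpace S] [SecondCountableTopology S]
    [MeasurableSpace S] [BorelSpace S]
    {Ω : Type*} [MeasurableSpace Ω] (P : Measure Ω) [IsProbabilityMeasure P] [P.IsComplete]
    (hP : Nonatomic P)
    (α : (Fin n → unitInterval) → ProbabilityMeasure S) (hα : Continuous α)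
    (X : Cube.boundary (Fin n) → (Ω →ₘ[P] S)) (hX : Continuous X)
    (hlaw : ∀ t : Cube.boundary (Fin n), L0.law (X t) = α t) :
    ∃ αhat : (Fin n → unitInterval) → (Ω →ₘ[P] S),
      Continuous αhat ∧
      (∀ t : Cube.boundary (Fin n), αhat t = X t) ∧
      (∀ t : Fin n → unitInterval, L0.law (αhat t) = α t) := by
  obtain ⟨e⟩ : Nonempty (ℕ ≃ ℕ × (Fin n → ℕ)) := nonempty_equiv_of_countable
  have hsum : ∀ t ∉ Cube.boundary (Fin n), HasSum (fun j => cubeBump (e j) t) 1 := fun t ht =>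
    (e.hasSum_iff (f := fun q => cubeBump q t)).2 (hasSum_cubeBump ht)
  have hcard : ∀ t, ∃ J : Finset ℕ, J.card ≤ 2 * 2 ^ n ∧ ∀ j ∉ J, cubeBump (e j) t = 0 := by
    intro t
    obtain ⟨J, hJN, hJ⟩ := exists_forall_cubeBump_eq_zero t
    refine ⟨J.image e.symm, Finset.card_image_le.trans hJN, fun j hj => hJ _ fun hmem => hj ?_⟩
    exact Finset.mem_image.2 ⟨e j, hmem, e.symm_apply_apply j⟩
  exact exists_extension_of_whitney hP continuous_cubeDepth
    (fun t ht => lt_of_le_of_ne (cubeDepth_nonneg t)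
      fun h => ht ((cubeDepth_eq_zero_iff t).1 h.symm))
    (fun t ht => (cubeDepth_eq_zero_iff t).2 ht) hα hX hlaw
    (φ := fun j => cubeBump (e j)) (fun j => continuous_cubeBump _)
    (fun j t => cubeBump_nonneg _ t) hsum hcard (c := 4)
    fun j t t' h h' => dist_le_of_cubeBump_ne_zero h h'
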